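/- Let $K\ge 2$ and let $X$ be the rooted $K$-ary tree with root $0$ (every vertex has exactly $K$ children), viewed as a metric graph with edges of length one; $|x|$ is the graph distance from $0$ to $x$ and $d|x|$ is the measure giving each edge Lebesgue measure $1$. Fix $\epsilon>0$ and $\beta>\log K$. Equip $X$ with the metric $d_X(x,y)=\int_{[x,y]}e^{-\epsilon|z|}\,d|z|$ and, for $\lambda\in\mathbb R$, with the measure $$d\mu_\lambda(x)=e^{-\beta|x|}(|x|+C)^\lambda\,d|x|,$$ where $C\ge\max\{2|\lambda|/(\beta-\log K),\,2(\log 4)/\epsilon\}$ is a fixed constant (which may depend on $\lambda$). A Borel function $g:X\to[0,\infty]$ is an upper gradient of $u:X\to\mathbb R$ if $|u(z)-u(y)|\le\int_{[z,y]}g\,ds_X$ for all $z,y\in X$, where $ds_X=e^{-\epsilon|z|}\,d|z|$. For $1\le p<\infty$, $N^{1,p}(X,\mu_\lambda)$ is the space of all $u\in L^1_{\rm loc}(X,\mu_\lambda)$ with $$\|u\|_{N^{1,p}(X,\mu_\lambda)}=\Big(\int_X|u|^p\,d\mu_\lambda+\inf_g\int_X g^p\,d\mu_\lambda\Big)^{1/p}<\infty,$$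 the infimum being over all upper gradients $g$ of $u$; $N^{1,p}(X)$ denotes $N^{1,p}(X,\mu_0)$. The boundary $\partial X$ is the set of infinite geodesics $[0,\xi)$ from the root, with the metric $d_X(\xi,\zeta)=\frac2\epsilon e^{-\epsilon k}$ if $[0,\xi)$ and $[0,\zeta)$ share exactly their first $k$ edges. Let $\nu$ be any Borel measure on $\partial X$ that is Ahlfors $Q$-regular with $Q=\log K/\epsilon$, i.e. $\nu(B(\xi,r))\approx r^{Q}$ for all $\xi\in\partial X$ and $0<r\le\operatorname{diam}\partial X$; $L^p(\partial X)=L^p(\partial X,\nu)$. Suppose $p=(\beta-\log K)/\epsilon\ge1$. 1. (Trace.) Let $\lambda>p-1$ if $p>1$, or $\lambda\ge0$ if $p=1$. Then there is a bounded linear operator $T:N^{1,p}(X,\mu_\lambda)\to L^p(\partial X)$ such that for every $u\in N^{1,p}(X,\mu_\lambda)$ and $\nu$-a.e. $\xi\in\partial X$ the limit of $u(x)$ as $x\to\xi$ along the geodesic ray $[0,\xi)$ exists and equals $Tu(\xi)$. 2. (Sharpness.) If $p>1$, $\delta>0$ and $\lambda=p-1-\delta$, then the function $u(x)=\log(|x|+1)$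 belongs to $N^{1,p}(X,\mu_\lambda)$, while $u(x)\to\infty$ as $x\to\xi$ along $[0,\xi)$ for every $\xi\in\partial X$. 3. (Extension.) There is a bounded, not necessarily linear, extension operator $E:L^p(\partial X)\to N^{1,p}(X)$, that is, $\|Ef\|_{N^{1,p}(X)}\le A\|f\|_{L^p(\partial X)}$ with a constant $A$ independent of $f$, that is a right inverse of the trace: for every $f\in L^p(\partial X)$ and $\nu$-a.e. $\xi\in\partial X$, the limit of $Ef(x)$ as $x\to\xi$ along $[0,\xi)$ exists and equals $f(\xi)$. -/

import Mathlib

open MeasureTheory Filter Topology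
open scoped ENNReal

/-- The length of the longest common prefix of two words. -/
def commonPrefixLength {α : Type*} [DecidableEq α] : List α → List α → ℕ
  | a :: l, b :: m => if a = b then commonPrefixLength l m + 1 else 0
  | _, _ => 0

theorem le_commonPrefixLength_iff {α : Type*} [DecidableEq α] (l m : List α) (n : ℕ) :
    n ≤ commonPrefixLength l m ↔ n ≤ l.length ∧ n ≤ m.length ∧ l.take n = m.take n := by
  induction l generalizing m n with
  | nil => cases n <;> simp [commonPrefixLength]
  | cons a l ih =>
    cases m with
    | nil => cases n <;> simp [commonPrefixLength]
    | cons b m =>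
      cases n with
      | zero => simp
      | succ n =>
        unfold commonPrefixLength
        split_ifs with h
        · simp [ih, h]
        · simp [h]

/-- The metric graph of the rooted `K`-ary tree. The vertices are the finite words in the letters
`0, …, K - 1`; the root is the empty word and the `K` children of `w` are the words `w ++ [i]`.
Every edge is a copy of the unit interval. A point is recorded by its distance `height` from the
root and by the first vertex `word` at or below it, so that the points with `word = w ++ [i]` form
the half-open edge from `w` (excluded) to `w ++ [i]` (included). The parameter `ε` only enters
through the metric. -/
@[ext]
structure RegularTree (K : ℕ) (ε : ℝ) where
  height : ℝ
  word : List (Fin K)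
  height_nonneg : 0 ≤ height
  length_word : word.length = ⌈height⌉₊

namespace RegularTree

variable {K : ℕ} {ε : ℝ}

/-- The vertex given by a word. -/
def vertex (ε : ℝ) (w : List (Fin K)) : RegularTree K ε where
  height := w.length
  word := w
  height_nonneg := Nat.cast_nonneg _
  length_word := by simp

/-- For `0 ≤ t ≤ |x|`, the point at height `t` on the geodesic from the root to `x`
(other values of `t` are moved to the nearest one in this range). -/
noncomputable def anc (x : RegularTree K ε) (t : ℝ) : RegularTree K ε where
  height := min (max t 0) x.height
  word := x.word.take ⌈min (max t 0) x.height⌉₊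
  height_nonneg := le_min (le_max_right _ _) x.height_nonneg
  length_word := by
    rw [List.length_take, x.length_word]
    exact min_eq_left (Nat.ceil_mono (min_le_right _ _))

/-- The height of the point at which the geodesics from the root to `x` and to `y` separate. -/
noncomputable def meetHeight (x y : RegularTree K ε) : ℝ :=
  min (min x.height y.height) (commonPrefixLength x.word y.word)

theorem meetHeight_comm (x y : RegularTree K ε) : meetHeight x y = meetHeight y x := by
  have h : commonPrefixLength x.word y.word = commonPrefixLength y.word x.word := by
    apply le_antisymm
    · rw [le_commonPrefixLength_iff]
      have := (le_commonPrefixLength_iff x.word y.word _).1 le_rfl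
      exact ⟨this.2.1, this.1, this.2.2.symm⟩
    · rw [le_commonPrefixLength_iff]
      have := (le_commonPrefixLength_iff y.word x.word _).1 le_rfl
      exact ⟨this.2.1, this.1, this.2.2.symm⟩
  rw [meetHeight, meetHeight, h, min_comm x.height]

theorem meetHeight_le_left (x y : RegularTree K ε) : meetHeight x y ≤ x.height :=
  (min_le_left _ _).trans (min_le_left _ _)

theorem meetHeight_le_right (x y : RegularTree K ε) : meetHeight x y ≤ y.height :=
  (min_le_left _ _).trans (min_le_right _ _)

theorem meetHeight_self (x : RegularTree K ε) : meetHeight x x = x.height := by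
  have h : x.word.length ≤ commonPrefixLength x.word x.word := by
    rw [le_commonPrefixLength_iff]; simp
  rw [x.length_word] at h
  have h' : x.height ≤ commonPrefixLength x.word x.word :=
    (Nat.le_ceil _).trans (by exact_mod_cast h)
  simp [meetHeight, h']

theorem min_meetHeight_le (x y z : RegularTree K ε) :
    min (meetHeight x y) (meetHeight y z) ≤ meetHeight x z := by
  have h : min (commonPrefixLength x.word y.word) (commonPrefixLength y.word z.word) ≤
      commonPrefixLength x.word z.word := by
    obtain ⟨a1, -, a3⟩ := (le_commonPrefixLength_iff x.word y.word _).1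
      (min_le_left _ (commonPrefixLength y.word z.word))
    obtain ⟨-, b2, b3⟩ := (le_commonPrefixLength_iff y.word z.word _).1
      (min_le_right (commonPrefixLength x.word y.word) _)
    exact (le_commonPrefixLength_iff _ _ _).2 ⟨a1, b2, a3.trans b3⟩
  have h' : min (commonPrefixLength x.word y.word : ℝ) (commonPrefixLength y.word z.word) ≤
      commonPrefixLength x.word z.word := by exact_mod_cast h
  refine le_min (le_min ?_ ?_) (le_trans (min_le_min ?_ ?_) h')
  · exact (min_le_left _ _).trans (meetHeight_le_left _ _)
  · exact (min_le_right _ _).trans (meetHeight_le_right _ _)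
  · exact min_le_right _ _
  · exact min_le_right _ _

theorem intervalIntegrable_weight (ε a b : ℝ) :
    IntervalIntegrable (fun t => Real.exp (-ε * t)) volume a b :=
  (by fun_prop : Continuous fun t : ℝ => Real.exp (-ε * t)).intervalIntegrable _ _

theorem integral_weight_nonneg (ε : ℝ) {a b : ℝ} (h : a ≤ b) :
    0 ≤ ∫ t in a..b, Real.exp (-ε * t) :=
  intervalIntegral.integral_nonneg h fun _ _ => (Real.exp_pos _).le

/-- The uniformizing distance `d_X(x, y) = ∫_{[x, y]} e^{-ε|z|} d|z|`; the geodesic `[x, y]`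
consists of the two segments that lead from the separation point to `x` and to `y`. -/
noncomputable instance : Dist (RegularTree K ε) where
  dist x y := (∫ t in (meetHeight x y)..x.height, Real.exp (-ε * t)) +
    ∫ t in (meetHeight x y)..y.height, Real.exp (-ε * t)

theorem dist_def (x y : RegularTree K ε) :
    dist x y = (∫ t in (meetHeight x y)..x.height, Real.exp (-ε * t)) +
      ∫ t in (meetHeight x y)..y.height, Real.exp (-ε * t) := rfl

noncomputable instance : MetricSpace (RegularTree K ε) where
  dist_self x := by simp [dist_def, meetHeight_self]
  dist_comm x y := by rw [dist_def, dist_def, meetHeight_comm, add_comm]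
  dist_triangle x y z := by
    simp only [dist_def]
    have hadd := fun a b c : ℝ => intervalIntegral.integral_add_adjacent_intervals
      (intervalIntegrable_weight ε a b) (intervalIntegrable_weight ε b c)
    have hxz := min_meetHeight_le x y z
    have h1 := meetHeight_le_right x y
    have h2 := meetHeight_le_left y z
    rcases le_total (meetHeight x y) (meetHeight y z) with h | h
    · rw [min_eq_left h] at hxz
      have e1 := hadd (meetHeight x y) (meetHeight x z) x.height
      have e2 := hadd (meetHeight x y) (meetHeight y z) z.height
      have e3 := hadd (meetHeight x y) (meetHeight x z) z.height
      have e4 := hadd (meetHeight x y) (meetHeight y z) y.height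
      have p1 := integral_weight_nonneg ε hxz
      have p3 := integral_weight_nonneg ε h2
      linarith
    · rw [min_eq_right h] at hxz
      have e1 := hadd (meetHeight y z) (meetHeight x y) x.height
      have e2 := hadd (meetHeight y z) (meetHeight x z) x.height
      have e3 := hadd (meetHeight y z) (meetHeight x z) z.height
      have e4 := hadd (meetHeight y z) (meetHeight x y) y.height
      have p1 := integral_weight_nonneg ε hxz
      have p3 := integral_weight_nonneg ε h1
      linarith
  eq_of_dist_eq_zero := by
    intro x y h
    rw [dist_def] at h
    have hl := meetHeight_le_left x y
    have hr := meetHeight_le_right x y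
    have p1 := integral_weight_nonneg ε hl
    have p2 := integral_weight_nonneg ε hr
    have key : ∀ b : ℝ, meetHeight x y ≤ b →
        (∫ t in (meetHeight x y)..b, Real.exp (-ε * t)) ≤ 0 → meetHeight x y = b := by
      intro b hb hi
      by_contra hne
      have := intervalIntegral.intervalIntegral_pos_of_pos
        (intervalIntegrable_weight ε (meetHeight x y) b) (fun _ => Real.exp_pos _)
        (lt_of_le_of_ne hb hne)
      linarith
    have hx := key _ hl (by linarith)
    have hy := key _ hr (by linarith)
    have hh : x.height = y.height := hx.symm.trans hy
    have hc : x.height ≤ commonPrefixLength x.word y.word := by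
      rw [← hx]; exact min_le_right _ _
    have hc' : ⌈x.height⌉₊ ≤ commonPrefixLength x.word y.word := Nat.ceil_le.2 hc
    obtain ⟨-, -, ht⟩ := (le_commonPrefixLength_iff _ _ _).1 hc'
    have hw : x.word = y.word := by
      rw [List.take_of_length_le x.length_word.le,
        List.take_of_length_le (by rw [y.length_word, hh])] at ht
      exact ht
    exact RegularTree.ext hh hw

noncomputable instance : MeasurableSpace (RegularTree K ε) := borel _

instance : BorelSpace (RegularTree K ε) := ⟨rfl⟩

theorem dist_anc_of_le (x : RegularTree K ε) {s t : ℝ} (hst : s ≤ t) :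
    dist (x.anc s) (x.anc t) = ∫ r in (x.anc s).height..(x.anc t).height, Real.exp (-ε * r) := by
  have hle : (x.anc s).height ≤ (x.anc t).height :=
    min_le_min (max_le_max hst le_rfl) le_rfl
  have hc : ⌈(x.anc s).height⌉₊ ≤ commonPrefixLength (x.anc s).word (x.anc t).word := by
    rw [le_commonPrefixLength_iff]
    refine ⟨(x.anc s).length_word.ge, (Nat.ceil_mono hle).trans (x.anc t).length_word.ge, ?_⟩
    simp only [anc, List.take_take]
    congr 1
    have := Nat.ceil_mono hle
    simp only [anc] at this
    omega
  have hm : meetHeight (x.anc s) (x.anc t) = (x.anc s).height := by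
    have : (x.anc s).height ≤ commonPrefixLength (x.anc s).word (x.anc t).word :=
      Nat.ceil_le.1 hc
    rw [meetHeight, min_eq_left hle, min_eq_left this]
  rw [dist_def, hm]
  simp

theorem continuous_anc (x : RegularTree K ε) : Continuous x.anc := by
  have hint : Continuous fun t : ℝ => ∫ r in (0 : ℝ)..t, Real.exp (-ε * r) :=
    intervalIntegral.continuous_primitive (fun a b => intervalIntegrable_weight ε a b) 0
  have hh : Continuous fun t : ℝ => (x.anc t).height := by
    simp only [anc]; fun_prop
  have hF := hint.comp hh
  have key : ∀ s t : ℝ, dist (x.anc s) (x.anc t) =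
      dist (∫ r in (0 : ℝ)..(x.anc s).height, Real.exp (-ε * r))
        (∫ r in (0 : ℝ)..(x.anc t).height, Real.exp (-ε * r)) := by
    have aux : ∀ s t : ℝ, s ≤ t → dist (x.anc s) (x.anc t) =
      dist (∫ r in (0 : ℝ)..(x.anc s).height, Real.exp (-ε * r))
        (∫ r in (0 : ℝ)..(x.anc t).height, Real.exp (-ε * r)) := by
      intro s t hst
      have hle : (x.anc s).height ≤ (x.anc t).height :=
        min_le_min (max_le_max hst le_rfl) le_rfl
      rw [dist_anc_of_le x hst, dist_comm, Real.dist_eq,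
        intervalIntegral.integral_interval_sub_left (intervalIntegrable_weight ε _ _)
          (intervalIntegrable_weight ε _ _),
        abs_of_nonneg (integral_weight_nonneg ε hle)]
    intro s t
    rcases le_total s t with h | h
    · exact aux s t h
    · rw [dist_comm, aux t s h, dist_comm]
  rw [Metric.continuous_iff'] at hF ⊢
  intro a η hη
  filter_upwards [hF a η hη] with s hs
  rw [key]
  exact hs

theorem anc_vertex_word (x : RegularTree K ε) : (vertex ε x.word).anc x.height = x := by
  have h : min (max x.height 0) (x.word.length : ℝ) = x.height := by
    rw [max_eq_left x.height_nonneg, x.length_word]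
    exact min_eq_left (Nat.le_ceil _)
  apply RegularTree.ext
  · exact h
  · simp only [anc, vertex, h, ← x.length_word, List.take_length]

instance : SecondCountableTopology (RegularTree K ε) := by
  have : TopologicalSpace.SeparableSpace (RegularTree K ε) := by
    rw [← TopologicalSpace.isSeparable_univ_iff]
    have h : (Set.univ : Set (RegularTree K ε)) =
        ⋃ w : List (Fin K), Set.range (vertex ε w).anc :=
      Eq.symm (Set.eq_univ_of_forall fun x =>
        Set.mem_iUnion.2 ⟨x.word, Set.mem_range.2 ⟨x.height, anc_vertex_word x⟩⟩)
    rw [h]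
    exact TopologicalSpace.IsSeparable.iUnion fun w =>
      TopologicalSpace.isSeparable_range (continuous_anc _)
  exact UniformSpace.secondCountable_of_separable _

/-- The integral `∫_γ g ds_X` over the geodesic `γ = [x, y]` with respect to the arc length
`ds_X = e^{-ε|z|} d|z|` of the metric `d_X`. -/
noncomputable def pathIntegral (g : RegularTree K ε → ℝ≥0∞) (x y : RegularTree K ε) : ℝ≥0∞ :=
  (∫⁻ t in Set.Ioc (meetHeight x y) x.height, g (x.anc t) * ENNReal.ofReal (Real.exp (-ε * t))) +
    ∫⁻ t in Set.Ioc (meetHeight x y) y.height, g (y.anc t) * ENNReal.ofReal (Real.exp (-ε * t))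

/-- A Borel function `g : X → [0, ∞]` is an upper gradient of `u`. -/
def IsUpperGradient (g : RegularTree K ε → ℝ≥0∞) (u : RegularTree K ε → ℝ) : Prop :=
  Measurable g ∧ ∀ z y, ENNReal.ofReal |u z - u y| ≤ pathIntegral g z y

/-- The measure `d|x|` that gives every edge Lebesgue measure one: the sum, over all edges
`[w, w ++ [i]]`, of the images of Lebesgue measure on `[|w|, |w| + 1]`. -/
noncomputable def lengthMeasure (K : ℕ) (ε : ℝ) : Measure (RegularTree K ε) :=
  Measure.sum fun e : List (Fin K) × Fin K =>
    (volume.restrict (Set.Icc (e.1.length : ℝ) (e.1.length + 1))).map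
      (vertex ε (e.1 ++ [e.2])).anc

/-- The weighted measure `dμ_l(x) = e^{-β|x|} (|x| + C)^l d|x|`. -/
noncomputable def weightedMeasure (K : ℕ) (ε β l C : ℝ) : Measure (RegularTree K ε) :=
  (lengthMeasure K ε).withDensity fun x =>
    ENNReal.ofReal (Real.exp (-β * x.height) * (x.height + C) ^ l)

/-- The Newtonian norm `(∫ |u|^p dμ + inf_g ∫ g^p dμ)^{1/p}` with values in `[0, ∞]`, the infimum
being taken over all upper gradients `g` of `u`. -/
noncomputable def newtonianENorm (p : ℝ) (μ : Measure (RegularTree K ε))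
    (u : RegularTree K ε → ℝ) : ℝ≥0∞ :=
  ((∫⁻ x, ‖u x‖ₑ ^ p ∂μ) +
    ⨅ (g : RegularTree K ε → ℝ≥0∞) (_ : IsUpperGradient g u), ∫⁻ x, g x ^ p ∂μ) ^ (1 / p)

theorem newtonianENorm_lt_top_iff {p : ℝ} (hp : 1 ≤ p) (μ : Measure (RegularTree K ε))
    (u : RegularTree K ε → ℝ) :
    newtonianENorm p μ u < ∞ ↔ (∫⁻ x, ‖u x‖ₑ ^ p ∂μ) < ∞ ∧
      ∃ g, IsUpperGradient g u ∧ (∫⁻ x, g x ^ p ∂μ) < ∞ := by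
  have hp0 : 0 < 1 / p := by positivity
  rw [newtonianENorm, ENNReal.rpow_lt_top_iff_of_pos hp0, ENNReal.add_lt_top]
  simp only [iInf_lt_iff, exists_prop]

theorem lintegral_add_rpow_lt_top {p : ℝ} (hp : 1 ≤ p) {μ : Measure (RegularTree K ε)}
    {f g h : RegularTree K ε → ℝ≥0∞} (hf : AEMeasurable f μ) (hh : ∀ x, h x ≤ f x + g x)
    (h1 : (∫⁻ x, f x ^ p ∂μ) < ∞) (h2 : (∫⁻ x, g x ^ p ∂μ) < ∞) :
    (∫⁻ x, h x ^ p ∂μ) < ∞ := by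
  calc (∫⁻ x, h x ^ p ∂μ) ≤ ∫⁻ x, (2 : ℝ≥0∞) ^ (p - 1) * (f x ^ p + g x ^ p) ∂μ :=
        lintegral_mono fun x => (ENNReal.rpow_le_rpow (hh x) (by linarith)).trans
          (ENNReal.rpow_add_le_mul_rpow_add_rpow _ _ hp)
    _ = 2 ^ (p - 1) * ((∫⁻ x, f x ^ p ∂μ) + ∫⁻ x, g x ^ p ∂μ) := by
        rw [lintegral_const_mul' _ _ (ENNReal.rpow_ne_top_of_nonneg (by linarith) (by simp)),
          lintegral_add_left' (hf.pow_const p)]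
    _ < ∞ := ENNReal.mul_lt_top
        (ENNReal.rpow_lt_top_of_nonneg (by linarith) (by simp)) (ENNReal.add_lt_top.2 ⟨h1, h2⟩)

/-- The Newtonian space `N^{1,p}(X, μ)`: the locally integrable functions of finite norm. -/
noncomputable def newtonianSpace (p : ℝ) (hp : 1 ≤ p) (μ : Measure (RegularTree K ε)) :
    Submodule ℝ (RegularTree K ε → ℝ) where
  carrier := {u | LocallyIntegrable u μ ∧ newtonianENorm p μ u < ∞}
  zero_mem' := by
    have hp0 : 0 < p := by linarith
    refine ⟨locallyIntegrable_zero, (newtonianENorm_lt_top_iff hp μ _).2 ⟨?_, 0, ⟨?_, ?_⟩, ?_⟩⟩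
    · simp [hp0]
    · exact measurable_const
    · simp
    · simp [hp0]
  add_mem' := by
    rintro u v ⟨hu, hu'⟩ ⟨hv, hv'⟩
    rw [newtonianENorm_lt_top_iff hp] at hu' hv'
    obtain ⟨iu, g, ⟨mg, hg⟩, ig⟩ := hu'
    obtain ⟨iv, h, ⟨mh, hh⟩, ih⟩ := hv'
    refine ⟨hu.add hv, (newtonianENorm_lt_top_iff hp μ _).2 ⟨?_, g + h, ⟨mg.add mh, ?_⟩, ?_⟩⟩
    · exact lintegral_add_rpow_lt_top hp hu.aestronglyMeasurable.enorm
        (fun x => enorm_add_le _ _) iu iv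
    · intro z y
      have e1 : |(u + v) z - (u + v) y| ≤ |u z - u y| + |v z - v y| := by
        simp only [Pi.add_apply, add_sub_add_comm]; exact abs_add_le _ _
      refine (ENNReal.ofReal_le_ofReal e1).trans ?_
      rw [ENNReal.ofReal_add (abs_nonneg _) (abs_nonneg _)]
      refine (add_le_add (hg z y) (hh z y)).trans ?_
      simp only [pathIntegral, Pi.add_apply, add_mul]
      rw [add_add_add_comm]
      exact add_le_add (le_lintegral_add _ _) (le_lintegral_add _ _)
    · exact lintegral_add_rpow_lt_top hp mg.aemeasurable (fun x => le_rfl) ig ih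
  smul_mem' := by
    rintro c u ⟨hu, hu'⟩
    have hp0 : 0 ≤ p := by linarith
    rw [newtonianENorm_lt_top_iff hp] at hu'
    obtain ⟨iu, g, ⟨mg, hg⟩, ig⟩ := hu'
    have hc : ‖c‖ₑ ^ p < ∞ := ENNReal.rpow_lt_top_of_nonneg hp0 (by simp)
    refine ⟨hu.smul c, (newtonianENorm_lt_top_iff hp μ _).2
      ⟨?_, fun x => ‖c‖ₑ * g x, ⟨mg.const_mul _, ?_⟩, ?_⟩⟩
    · simp only [Pi.smul_apply, enorm_smul, ENNReal.mul_rpow_of_nonneg _ _ hp0]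
      rw [lintegral_const_mul' _ _ hc.ne]
      exact ENNReal.mul_lt_top hc iu
    · intro z y
      have e1 : |(c • u) z - (c • u) y| = ‖c‖ * |u z - u y| := by
        simp only [Pi.smul_apply, smul_eq_mul, ← mul_sub, abs_mul, Real.norm_eq_abs]
      rw [e1, ENNReal.ofReal_mul (norm_nonneg _), ofReal_norm]
      refine (mul_le_mul_right (hg z y) _).trans_eq ?_
      simp only [pathIntegral, mul_assoc]
      rw [lintegral_const_mul' _ _ enorm_ne_top, lintegral_const_mul' _ _ enorm_ne_top, mul_add]
    · simp only [ENNReal.mul_rpow_of_nonneg _ _ hp0]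
      rw [lintegral_const_mul' _ _ hc.ne]
      exact ENNReal.mul_lt_top hc ig

/-- The norm of a function in the Newtonian space, as a real number. -/
noncomputable def newtonianNorm (p : ℝ) (μ : Measure (RegularTree K ε))
    (u : RegularTree K ε → ℝ) : ℝ :=
  (newtonianENorm p μ u).toReal

end RegularTree

/-- The boundary of the `K`-ary tree: a boundary point is an infinite geodesic that starts at the
root, that is, an infinite word. It carries the product topology (which is the topology of the
visual metric below) and its Borel sets. -/
abbrev TreeBoundary (K : ℕ) : Type := ℕ → Fin K

namespace TreeBoundary

variable {K : ℕ}

/-- The point at height `t ≥ 0` on the geodesic ray `[0, ξ)`. -/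
noncomputable def ray (ε : ℝ) (ξ : TreeBoundary K) (t : ℝ) : RegularTree K ε where
  height := max t 0
  word := List.ofFn fun i : Fin ⌈max t 0⌉₊ => ξ i
  height_nonneg := le_max_right _ _
  length_word := by simp

open Classical in
/-- The visual metric: if the rays to `ξ ≠ ζ` have exactly their first `k` edges in common, then
`d_X(ξ, ζ) = 2 ∫_k^∞ e^{-εt} dt = (2 / ε) e^{-εk}`. -/
noncomputable def visualDist (ε : ℝ) (ξ ζ : TreeBoundary K) : ℝ :=
  if ξ = ζ then 0 else 2 / ε * Real.exp (-ε * (PiNat.firstDiff ξ ζ : ℕ))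

/-- `ν` is Ahlfors `Q`-regular for the visual metric: the measure of every ball `B(ξ, r)` with
`0 < r ≤ diam ∂X = 2 / ε` is comparable to `r ^ Q`. -/
def AhlforsRegular (ε Q : ℝ) (ν : Measure (TreeBoundary K)) : Prop :=
  ∃ A : ℝ, 1 ≤ A ∧ ∀ (ξ : TreeBoundary K) (r : ℝ), 0 < r → r ≤ 2 / ε →
    ENNReal.ofReal (A⁻¹ * r ^ Q) ≤ ν {ζ | visualDist ε ξ ζ < r} ∧
      ν {ζ | visualDist ε ξ ζ < r} ≤ ENNReal.ofReal (A * r ^ Q)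

end TreeBoundary

/-!
The proof transfers everything to the geodesic rays. For an Ahlfors regular `ν`, the set of rays
through an edge at height about `t` has measure comparable to `K ^ (-t) = e^{-t log K}`. Hence
integration against `μ_l` is, up to constants, integration over all rays with respect to `ν`, with
the weight `e^{-(β - log K) t} (t + C)^l` along each ray
(`RegularTree.lintegral_weightedMeasure_comparable`). Since `β - log K = ε p`, this weight combines
with the arc length `e^{-ε t} dt` so that all exponentials cancel in the gradient terms.

*Trace.* By Hölder's inequality on a ray, with the dual weight `(t + C) ^ (-l / (p - 1))`, which is
integrable for `l > p - 1`, the integral of an upper gradient over the ray to `ξ` is in `L^p(ν)`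
as a function of `ξ` (`RegularTree.exists_lintegral_rayIntegral_rpow_le`). Where it is finite, the
function has a limit along the ray, and the limit is at most the value at any point of the ray plus
that integral; averaging over the points of the ray bounds the limit in `L^p`
(`RegularTree.exists_lintegral_limit_le`).

*Sharpness.* The function `log (|x| + 1)` has the upper gradient `e^{ε|x|} / (|x| + 1)`, and its
energy is comparable to `∫ (t + 1)^{-p} (t + C)^{p - 1 - δ} dt`, which is finite
(`RegularTree.log_height_mem_newtonianSpace`).

*Extension.* If a vertex function `H` is interpolated affinely on the edges, its energy in the
unweighted space is comparable to the sum over `n` of `∫ |H_{n+1} - H_n|^p dν`, where `H_n(ξ)` is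
the value of `H` at the vertex of height `n` on the ray to `ξ`
(`RegularTree.exists_interpolate_bound`). Functions of finitely many letters are dense in `L^p`, so
that `f` is the limit of such functions `F_k` with errors `∫ |F_k - f|^p ≤ 2^{-k} ∫ |f|^p` and
`F_0 = 0`. Taking `H_n = F_k`, with `k` growing so slowly that `F_k` depends on at most `n` letters,
makes the energy summable with the right bound (`TreeBoundary.exists_vertexFunction`). The choice
of the `F_k` makes the extension nonlinear.
-/

/-! ### Points of the tree and prefixes of boundary points -/

namespace TreeBoundary

variable {K : ℕ} {ε : ℝ}

/-- The word of the first `n` letters of `ξ`, that is, the vertex at height `n` on the ray. -/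
def prefixWord (ξ : TreeBoundary K) (n : ℕ) : List (Fin K) :=
  List.ofFn fun i : Fin n => ξ i

/-- The set of boundary points whose ray passes through the vertex `w`. -/
def cylinder (w : List (Fin K)) : Set (TreeBoundary K) :=
  {ξ | prefixWord ξ w.length = w}

@[simp]
theorem length_prefixWord (ξ : TreeBoundary K) (n : ℕ) : (prefixWord ξ n).length = n := by
  simp [prefixWord]

theorem take_prefixWord (ξ : TreeBoundary K) {m n : ℕ} (h : m ≤ n) :
    (prefixWord ξ n).take m = prefixWord ξ m := by
  apply List.ext_getElem
  · simp [h]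
  · intro i h1 h2
    simp [prefixWord]

theorem prefixWord_succ (ξ : TreeBoundary K) (n : ℕ) :
    prefixWord ξ (n + 1) = prefixWord ξ n ++ [ξ n] := by
  rw [prefixWord, List.ofFn_succ_last]
  simp [prefixWord]

theorem prefixWord_eq_iff (ξ ζ : TreeBoundary K) (n : ℕ) :
    prefixWord ζ n = prefixWord ξ n ↔ ∀ i < n, ζ i = ξ i := by
  simp only [prefixWord, List.ofFn_inj, funext_iff, Fin.forall_iff]

theorem measurable_prefixWord (n : ℕ) :
    @Measurable _ _ _ ⊤ fun ξ : TreeBoundary K => prefixWord ξ n := by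
  let _ : MeasurableSpace (List (Fin K)) := ⊤
  refine (measurable_from_top (f := fun v : Fin n → Fin K => List.ofFn v)).comp
    (?_ : @Measurable _ _ _ ⊤ fun (ξ : TreeBoundary K) (i : Fin n) => ξ i)
  rw [show (⊤ : MeasurableSpace (Fin n → Fin K)) = MeasurableSpace.pi from
    (top_le_iff.1 fun s _ => s.toFinite.measurableSet).symm]
  exact measurable_pi_lambda _ fun i => measurable_pi_apply _

theorem measurable_comp_prefixWord {α : Type*} [MeasurableSpace α] (H : List (Fin K) → α) (n : ℕ) :
    Measurable fun ξ : TreeBoundary K => H (prefixWord ξ n) := by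
  let _ : MeasurableSpace (List (Fin K)) := ⊤
  exact (measurable_from_top (f := H)).comp (measurable_prefixWord n)

theorem measurableSet_cylinder (w : List (Fin K)) : MeasurableSet (cylinder w) := by
  let _ : MeasurableSpace (List (Fin K)) := ⊤
  exact measurable_prefixWord w.length (MeasurableSpace.measurableSet_top (s := {w}))

theorem ray_height (ξ : TreeBoundary K) {t : ℝ} (ht : 0 ≤ t) : (ray ε ξ t).height = t :=
  max_eq_left ht

theorem ray_word (ξ : TreeBoundary K) {t : ℝ} (ht : 0 ≤ t) :
    (ray ε ξ t).word = prefixWord ξ ⌈t⌉₊ := by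
  have : max t 0 = t := max_eq_left ht
  apply List.ext_getElem
  · simp [ray, this]
  · intro i h1 h2
    simp [ray, prefixWord]

theorem anc_ray (ξ : TreeBoundary K) {s t : ℝ} (hs : 0 ≤ s) (hst : s ≤ t) :
    (ray ε ξ t).anc s = ray ε ξ s := by
  have e : min (max s 0) (ray ε ξ t).height = s := by
    rw [ray_height ξ (hs.trans hst), max_eq_left hs, min_eq_left hst]
  apply RegularTree.ext
  · rw [ray_height ξ hs]; exact e
  · rw [ray_word ξ hs]
    simp only [RegularTree.anc, e]
    rw [ray_word ξ (hs.trans hst), take_prefixWord ξ (Nat.ceil_mono hst)]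

theorem ray_natCast (ξ : TreeBoundary K) (n : ℕ) :
    ray ε ξ n = RegularTree.vertex ε (prefixWord ξ n) := by
  apply RegularTree.ext
  · rw [ray_height ξ (Nat.cast_nonneg n)]; simp [RegularTree.vertex]
  · rw [ray_word ξ (Nat.cast_nonneg n)]; simp [RegularTree.vertex]

theorem anc_vertex_prefixWord (ξ : TreeBoundary K) {t : ℝ} {n : ℕ} (ht : 0 ≤ t) (htn : t ≤ n) :
    (RegularTree.vertex ε (prefixWord ξ n)).anc t = ray ε ξ t := by
  rw [← ray_natCast, anc_ray ξ ht htn]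

end TreeBoundary

namespace RegularTree

variable {K : ℕ} {ε : ℝ}

theorem anc_height (x : RegularTree K ε) {t : ℝ} (h0 : 0 ≤ t) (ht : t ≤ x.height) :
    (x.anc t).height = t := by
  simp [anc, h0, ht]

theorem anc_word (x : RegularTree K ε) {t : ℝ} (h0 : 0 ≤ t) (ht : t ≤ x.height) :
    (x.anc t).word = x.word.take ⌈t⌉₊ := by
  simp [anc, h0, ht]

theorem anc_self (x : RegularTree K ε) : x.anc x.height = x := by
  apply RegularTree.ext
  · exact anc_height x x.height_nonneg le_rfl
  · rw [anc_word x x.height_nonneg le_rfl, ← x.length_word, List.take_length]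

theorem meetHeight_nonneg (x y : RegularTree K ε) : 0 ≤ meetHeight x y :=
  le_min (le_min x.height_nonneg y.height_nonneg) (Nat.cast_nonneg _)

theorem anc_meetHeight (x y : RegularTree K ε) :
    x.anc (meetHeight x y) = y.anc (meetHeight x y) := by
  have h0 := meetHeight_nonneg x y
  have hl := meetHeight_le_left x y
  have hr := meetHeight_le_right x y
  apply RegularTree.ext
  · rw [anc_height x h0 hl, anc_height y h0 hr]
  · rw [anc_word x h0 hl, anc_word y h0 hr]
    have hc : ⌈meetHeight x y⌉₊ ≤ commonPrefixLength x.word y.word :=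
      Nat.ceil_le.2 (min_le_right _ _)
    exact ((le_commonPrefixLength_iff _ _ _).1 hc).2.2

theorem meetHeight_anc_left (x : RegularTree K ε) {s : ℝ} (hs : 0 ≤ s) (hsx : s ≤ x.height) :
    meetHeight (x.anc s) x = s := by
  have hh := anc_height x hs hsx
  have hc : ⌈s⌉₊ ≤ commonPrefixLength (x.anc s).word x.word := by
    rw [le_commonPrefixLength_iff, anc_word x hs hsx, List.take_take, min_self]
    have := Nat.ceil_mono hsx
    rw [← x.length_word] at this
    simp [this]
  have hc' : s ≤ commonPrefixLength (x.anc s).word x.word := Nat.ceil_le.1 hc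
  rw [meetHeight, hh, min_eq_left hsx, min_eq_left hc']

/-- Along a segment that points away from the root, the path integral is a single integral. -/
theorem pathIntegral_anc_left (g : RegularTree K ε → ℝ≥0∞) (x : RegularTree K ε) {s : ℝ}
    (hs : 0 ≤ s) (hsx : s ≤ x.height) :
    pathIntegral g (x.anc s) x =
      ∫⁻ t in Set.Ioc s x.height, g (x.anc t) * ENNReal.ofReal (Real.exp (-ε * t)) := by
  simp [pathIntegral, meetHeight_anc_left x hs hsx, anc_height x hs hsx]

/-- A function is an upper gradient as soon as it is one along the geodesics that point away from
the root. -/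
theorem isUpperGradient_of_anc {g : RegularTree K ε → ℝ≥0∞} {u : RegularTree K ε → ℝ}
    (hg : Measurable g)
    (h : ∀ (x : RegularTree K ε) (s : ℝ), 0 ≤ s → s ≤ x.height →
      ENNReal.ofReal |u x - u (x.anc s)| ≤
        ∫⁻ t in Set.Ioc s x.height, g (x.anc t) * ENNReal.ofReal (Real.exp (-ε * t))) :
    IsUpperGradient g u := by
  refine ⟨hg, fun z y => ?_⟩
  have h0 := meetHeight_nonneg z y
  have h1 := h z _ h0 (meetHeight_le_left z y)
  have h2 := h y _ h0 (meetHeight_le_right z y)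
  refine le_trans ?_ (add_le_add h1 h2)
  rw [← ENNReal.ofReal_add (abs_nonneg _) (abs_nonneg _)]
  apply ENNReal.ofReal_le_ofReal
  rw [anc_meetHeight]
  rw [abs_sub_comm (u y)]
  exact abs_sub_le _ _ _

theorem dist_root (hε : 0 < ε) (x : RegularTree K ε) :
    dist x (vertex ε []) = (1 - Real.exp (-ε * x.height)) / ε := by
  have hm : meetHeight x (vertex ε []) = 0 := by
    have : commonPrefixLength x.word ([] : List (Fin K)) = 0 := by
      cases x.word <;> rfl
    simp [meetHeight, vertex, this, x.height_nonneg]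
  rw [dist_def, hm]
  have : (vertex ε ([] : List (Fin K))).height = 0 := by simp [vertex]
  rw [this, intervalIntegral.integral_same, add_zero]
  have hd : ∀ t ∈ Set.uIcc 0 x.height, HasDerivAt (fun t => -Real.exp (-ε * t) / ε)
      (Real.exp (-ε * t)) t := fun t _ => by
    have := ((hasDerivAt_id t).const_mul (-ε)).exp.neg.div_const ε
    refine this.congr_deriv ?_
    simp only [id]
    field_simp
  rw [intervalIntegral.integral_eq_sub_of_hasDerivAt hd (intervalIntegrable_weight ε _ _)]
  simp; ring


/-- The distance to the root determines the height through an explicit continuous function. -/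
theorem continuous_height (hε : 0 < ε) : Continuous (height : RegularTree K ε → ℝ) := by
  have h : ∀ x : RegularTree K ε,
      x.height = -Real.log (1 - ε * dist x (vertex ε [])) / ε := fun x => by
    rw [dist_root hε, mul_div_cancel₀ _ hε.ne', sub_sub_cancel, Real.log_exp]
    field_simp
  rw [funext h]
  refine (Continuous.log (by fun_prop) fun x => ?_).neg.div_const ε
  rw [dist_root hε, mul_div_cancel₀ _ hε.ne', sub_sub_cancel]
  exact (Real.exp_pos _).ne'

/-- The half-open edge above the vertex `w` is cut out of the compact segment from the root to `w`
by a condition on the height. -/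
theorem measurableSet_word_eq (hε : 0 < ε) (w : List (Fin K)) :
    MeasurableSet {x : RegularTree K ε | x.word = w} := by
  have hc : IsClosed ((vertex ε w).anc '' Set.Icc 0 w.length) :=
    (isCompact_Icc.image (continuous_anc _)).isClosed
  have h : {x : RegularTree K ε | x.word = w} =
      (vertex ε w).anc '' Set.Icc 0 w.length ∩ height ⁻¹' {t | ⌈t⌉₊ = w.length} := by
    ext x
    constructor
    · rintro rfl
      refine ⟨⟨x.height, ⟨x.height_nonneg, ?_⟩, anc_vertex_word x⟩, x.length_word.symm⟩
      rw [x.length_word]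
      exact Nat.le_ceil _
    · rintro ⟨⟨t, ht, rfl⟩, hx⟩
      have htv : t ≤ (vertex ε w).height := ht.2
      simp only [Set.mem_preimage, Set.mem_ofPred_eq, anc_height _ ht.1 htv] at hx
      change ((vertex ε w).anc t).word = w
      rw [anc_word _ ht.1 htv, hx]
      exact List.take_length
  rw [h]
  exact hc.measurableSet.inter ((continuous_height hε).measurable
    (Nat.measurable_ceil (measurableSet_singleton _)))

/-- A function that is, on each edge, a measurable function of the height is measurable. -/
theorem measurable_of_word_height {α : Type*} [MeasurableSpace α] (hε : 0 < ε)
    {φ : List (Fin K) → ℝ → α} (hφ : ∀ w, Measurable (φ w)) :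
    Measurable fun x : RegularTree K ε => φ x.word x.height := by
  intro s hs
  have : (fun x : RegularTree K ε => φ x.word x.height) ⁻¹' s =
      ⋃ w, {x : RegularTree K ε | x.word = w} ∩ (fun x => φ w x.height) ⁻¹' s := by
    ext x
    simp
  rw [this]
  exact MeasurableSet.iUnion fun w => (measurableSet_word_eq hε w).inter
    (((hφ w).comp (continuous_height hε).measurable) hs)

theorem measurable_ray :
    Measurable fun q : TreeBoundary K × ℝ => TreeBoundary.ray ε q.1 q.2 := by
  intro s hs
  have hpos : ∀ (ξ : TreeBoundary K) (t : ℝ),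
      TreeBoundary.ray ε ξ t = TreeBoundary.ray ε ξ (max t 0) := by
    intro ξ t
    simp [TreeBoundary.ray]
  have : (fun q : TreeBoundary K × ℝ => TreeBoundary.ray ε q.1 q.2) ⁻¹' s =
      ⋃ w : List (Fin K), TreeBoundary.cylinder w ×ˢ
        ({t : ℝ | ⌈t⌉₊ = w.length} ∩ (fun t => (vertex ε w).anc (max t 0)) ⁻¹' s) := by
    ext ⟨ξ, t⟩
    have key : (vertex ε (TreeBoundary.prefixWord ξ ⌈t⌉₊)).anc (max t 0) =
        TreeBoundary.ray ε ξ t := by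
      rw [hpos ξ t]
      exact TreeBoundary.anc_vertex_prefixWord ξ (le_max_right _ _)
        (max_le (Nat.le_ceil _) (Nat.cast_nonneg _))
    simp only [Set.mem_preimage, Set.mem_iUnion, Set.mem_prod, Set.mem_inter_iff,
      Set.mem_ofPred_eq, TreeBoundary.cylinder]
    constructor
    · intro h
      refine ⟨TreeBoundary.prefixWord ξ ⌈t⌉₊, ?_, ?_, ?_⟩
      · simp
      · simp
      · rwa [key]
    · rintro ⟨w, h1, h2, h3⟩
      rw [← h2] at h1
      rw [← h1, key] at h3
      exact h3
  rw [this]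
  exact MeasurableSet.iUnion fun w => (TreeBoundary.measurableSet_cylinder w).prod
    ((Nat.measurable_ceil (measurableSet_singleton _)).inter
      (((continuous_anc _).comp (by fun_prop : Continuous fun t : ℝ => max t 0)).measurable hs))

/-- Integration over the tree, edge by edge. -/
theorem lintegral_lengthMeasure {h : RegularTree K ε → ℝ≥0∞} (hh : Measurable h) :
    ∫⁻ x, h x ∂lengthMeasure K ε = ∑' e : List (Fin K) × Fin K,
      ∫⁻ t in Set.Ioc (e.1.length : ℝ) (e.1.length + 1), h ((vertex ε (e.1 ++ [e.2])).anc t) := by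
  rw [lengthMeasure, lintegral_sum_measure]
  congr 1 with e
  rw [lintegral_map hh (continuous_anc _).measurable, restrict_Ioc_eq_restrict_Icc]

theorem lintegral_Ioi_eq_tsum (φ : ℝ → ℝ≥0∞) :
    ∫⁻ t in Set.Ioi 0, φ t = ∑' n : ℕ, ∫⁻ t in Set.Ioc (n : ℝ) (n + 1), φ t := by
  have hu : (⋃ n : ℕ, Set.Ioc (n : ℝ) (n + 1)) = Set.Ioi 0 := by
    ext t
    simp only [Set.mem_iUnion, Set.mem_Ioc, Set.mem_Ioi]
    constructor
    · rintro ⟨n, h, -⟩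
      exact (Nat.cast_nonneg n).trans_lt h
    · intro ht
      obtain ⟨m, hm⟩ := Nat.exists_eq_succ_of_ne_zero (Nat.ceil_pos.2 ht).ne'
      have h1 : ⌈t⌉₊ ≤ m + 1 := hm.le
      have h2 : m < ⌈t⌉₊ := by omega
      exact ⟨m, Nat.lt_ceil.1 h2, by simpa using Nat.ceil_le.1 h1⟩
  rw [← hu, lintegral_iUnion (fun _ => measurableSet_Ioc)]
  intro m n hmn
  refine Set.disjoint_left.2 fun t hm hn => hmn ?_
  have h1 : (m : ℝ) < n + 1 := hm.1.trans_le hn.2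
  have h2 : (n : ℝ) < m + 1 := hn.1.trans_le hm.2
  norm_cast at h1 h2
  omega

/-- Integration over all rays, edge by edge: an edge is counted with the measure of the set of
rays that run through it. -/
theorem lintegral_lintegral_ray {h : RegularTree K ε → ℝ≥0∞} (ν : Measure (TreeBoundary K)) :
    ∫⁻ ξ, (∫⁻ t in Set.Ioi 0, h (TreeBoundary.ray ε ξ t)) ∂ν = ∑' e : List (Fin K) × Fin K,
      ν (TreeBoundary.cylinder (e.1 ++ [e.2])) *
      ∫⁻ t in Set.Ioc (e.1.length : ℝ) (e.1.length + 1), h ((vertex ε (e.1 ++ [e.2])).anc t) := by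
  set I : List (Fin K) × Fin K → ℝ≥0∞ := fun e =>
    ∫⁻ t in Set.Ioc (e.1.length : ℝ) (e.1.length + 1), h ((vertex ε (e.1 ++ [e.2])).anc t)
  have hξ : ∀ ξ : TreeBoundary K, ∫⁻ t in Set.Ioi 0, h (TreeBoundary.ray ε ξ t) =
      ∑' e : List (Fin K) × Fin K,
        (TreeBoundary.cylinder (e.1 ++ [e.2])).indicator (fun _ => I e) ξ := by
    intro ξ
    -- the edges on the ray to `ξ` are those whose cylinder contains `ξ`, one for each height
    have hinj : Function.Injective fun n : ℕ => (TreeBoundary.prefixWord ξ n, ξ n) := by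
      intro m n hmn
      simpa using congrArg (fun e : List (Fin K) × Fin K => e.1.length) hmn
    rw [lintegral_Ioi_eq_tsum, ← hinj.tsum_eq]
    · congr 1 with n
      have hmem : ξ ∈ TreeBoundary.cylinder (TreeBoundary.prefixWord ξ n ++ [ξ n]) := by
        simp [TreeBoundary.cylinder, TreeBoundary.prefixWord_succ]
      rw [Set.indicator_of_mem hmem]
      simp only [I, TreeBoundary.length_prefixWord, ← TreeBoundary.prefixWord_succ]
      refine setLIntegral_congr_fun measurableSet_Ioc fun t ht => ?_
      rw [TreeBoundary.anc_vertex_prefixWord ξ ((Nat.cast_nonneg n).trans ht.1.le)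
        (by exact_mod_cast ht.2)]
    · rintro ⟨v, i⟩ he
      have hmem : ξ ∈ TreeBoundary.cylinder (v ++ [i]) := by
        by_contra hne
        exact he (Set.indicator_of_notMem hne _)
      simp only [TreeBoundary.cylinder, Set.mem_ofPred_eq, List.length_append,
        List.length_singleton, TreeBoundary.prefixWord_succ] at hmem
      obtain ⟨h1, h2⟩ := List.append_inj' hmem rfl
      refine ⟨v.length, ?_⟩
      simp only [List.cons.injEq, and_true] at h2
      simp [h1, h2]
  rw [lintegral_congr hξ, lintegral_tsum fun e =>
    (measurable_const.indicator (TreeBoundary.measurableSet_cylinder _)).aemeasurable]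
  congr 1 with e
  rw [lintegral_indicator (TreeBoundary.measurableSet_cylinder _), setLIntegral_const, mul_comm]

end RegularTree

/-! ### The boundary measure and the measures on the tree -/

namespace TreeBoundary

variable {K : ℕ} {ε : ℝ}

theorem exists_prefixWord_eq (hK : 0 < K) (w : List (Fin K)) :
    ∃ ξ : TreeBoundary K, prefixWord ξ w.length = w := by
  refine ⟨fun i => w.getD i ⟨0, hK⟩, ?_⟩
  apply List.ext_getElem
  · simp
  · intro i h1 h2
    simp [prefixWord]

/-- Cylinders of positive length are balls of the visual metric. -/
theorem ball_eq_cylinder (hε : 0 < ε) (ξ : TreeBoundary K) (n : ℕ) :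
    {ζ | visualDist ε ξ ζ < 2 / ε * Real.exp (-ε * n)} = cylinder (prefixWord ξ (n + 1)) := by
  ext ζ
  simp only [Set.mem_ofPred_eq, cylinder, length_prefixWord]
  rw [prefixWord_eq_iff]
  by_cases h : ξ = ζ
  · subst h
    simp only [visualDist, if_true, implies_true, iff_true]
    positivity
  · rw [visualDist, if_neg h, mul_lt_mul_iff_right₀ (by positivity), Real.exp_lt_exp]
    have h1 := PiNat.mem_cylinder_iff_le_firstDiff h (n + 1)
    rw [PiNat.mem_cylinder_iff] at h1
    have h2 : (∀ i < n + 1, ζ i = ξ i) ↔ n + 1 ≤ PiNat.firstDiff ξ ζ := by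
      rw [← h1]
      exact forall₂_congr fun _ _ => eq_comm
    rw [h2, Nat.succ_le_iff, neg_mul, neg_mul, neg_lt_neg_iff, mul_lt_mul_iff_right₀ hε,
      Nat.cast_lt]

/-- An Ahlfors regular measure gives a cylinder of length `n ≥ 1` a mass comparable to
`K ^ (-n)`. -/
theorem AhlforsRegular.measure_cylinder (hK : 2 ≤ K) (hε : 0 < ε) {ν : Measure (TreeBoundary K)}
    (hν : AhlforsRegular ε (Real.log K / ε) ν) :
    ∃ a b : ℝ, 0 < a ∧ 0 < b ∧ ∀ w : List (Fin K), w ≠ [] →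
      ENNReal.ofReal (a * Real.exp (-Real.log K * w.length)) ≤ ν (cylinder w) ∧
      ν (cylinder w) ≤ ENNReal.ofReal (b * Real.exp (-Real.log K * w.length)) := by
  obtain ⟨A, hA, h⟩ := hν
  have hK0 : (0 : ℝ) < K := by positivity
  set c : ℝ := (2 / ε) ^ (Real.log K / ε) * K with hc
  have hc0 : 0 < c := by positivity
  refine ⟨A⁻¹ * c, A * c, by positivity, by positivity, fun w hw => ?_⟩
  obtain ⟨ξ, hξ⟩ := exists_prefixWord_eq (by omega) w
  obtain ⟨n, hn⟩ := Nat.exists_eq_succ_of_ne_zero (List.length_pos_iff.2 hw).ne'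
  rw [hn] at hξ
  have hr := h ξ (2 / ε * Real.exp (-ε * n)) (by positivity) (by
    refine mul_le_of_le_one_right (by positivity) (Real.exp_le_one_iff.2 ?_)
    have : 0 ≤ ε * n := by positivity
    linarith)
  have e : (2 / ε * Real.exp (-ε * n)) ^ (Real.log K / ε) =
      c * Real.exp (-Real.log K * w.length) := by
    have hKe : (K : ℝ) * Real.exp (-Real.log K * w.length) =
        Real.exp (Real.log K + -Real.log K * w.length) := by
      rw [Real.exp_add, Real.exp_log hK0]
    rw [Real.mul_rpow (by positivity) (Real.exp_pos _).le, ← Real.exp_mul, hc,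
      mul_assoc _ (K : ℝ), hKe, hn]
    congr 2
    push_cast
    field_simp
    ring
  rw [ball_eq_cylinder hε, e, hξ] at hr
  simpa only [mul_assoc] using hr

theorem AhlforsRegular.isFiniteMeasure (hK : 2 ≤ K) (hε : 0 < ε) {ν : Measure (TreeBoundary K)}
    (hν : AhlforsRegular ε (Real.log K / ε) ν) : IsFiniteMeasure ν := by
  obtain ⟨a, b, -, -, h⟩ := hν.measure_cylinder hK hε
  have hu : (Set.univ : Set (TreeBoundary K)) = ⋃ i : Fin K, cylinder [i] :=
    (Set.eq_univ_of_forall fun ξ => Set.mem_iUnion.2 ⟨ξ 0, by simp [cylinder, prefixWord]⟩).symm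
  rw [isFiniteMeasure_iff, hu]
  refine (measure_iUnion_le _).trans_lt ?_
  rw [tsum_fintype]
  refine ENNReal.sum_lt_top.2 fun i _ => ?_
  exact (h [i] (by simp)).2.trans_lt ENNReal.ofReal_lt_top

end TreeBoundary

namespace RegularTree

variable {K : ℕ} {ε : ℝ}

/-- The weight `e^{-at} (t + C)^l` as a function of the height `t`. -/
noncomputable def radialWeight (a l C t : ℝ) : ℝ≥0∞ :=
  ENNReal.ofReal (Real.exp (-a * t) * (t + C) ^ l)

theorem measurable_radialWeight (a l C : ℝ) : Measurable (radialWeight a l C) := by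
  unfold radialWeight
  fun_prop

theorem radialWeight_eq_mul (a b l C t : ℝ) :
    radialWeight a l C t = radialWeight (a - b) l C t * ENNReal.ofReal (Real.exp (-b * t)) := by
  rw [radialWeight, radialWeight, ← ENNReal.ofReal_mul' (Real.exp_pos _).le, mul_right_comm,
    ← Real.exp_add]
  ring_nf

theorem lintegral_weightedMeasure (hε : 0 < ε) (β l C : ℝ) {h : RegularTree K ε → ℝ≥0∞}
    (hh : Measurable h) :
    ∫⁻ x, h x ∂weightedMeasure K ε β l C = ∑' e : List (Fin K) × Fin K,
      ∫⁻ t in Set.Ioc (e.1.length : ℝ) (e.1.length + 1),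
        h ((vertex ε (e.1 ++ [e.2])).anc t) * radialWeight β l C t := by
  have hw : Measurable fun x : RegularTree K ε => radialWeight β l C x.height :=
    (measurable_radialWeight β l C).comp (continuous_height hε).measurable
  change ∫⁻ x, h x ∂(lengthMeasure K ε).withDensity (fun x => radialWeight β l C x.height) = _
  rw [lintegral_withDensity_eq_lintegral_mul _ hw hh, lintegral_lengthMeasure (hw.mul hh)]
  congr 1 with e
  refine setLIntegral_congr_fun measurableSet_Ioc fun t ht => ?_
  have : ((vertex ε (e.1 ++ [e.2])).anc t).height = t :=
    anc_height _ ((Nat.cast_nonneg _).trans ht.1.le) (by simpa [vertex] using ht.2)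
  simp only [Pi.mul_apply, this, mul_comm]

theorem lintegral_lintegral_ray_radialWeight (a l C : ℝ)
    (h : RegularTree K ε → ℝ≥0∞) (ν : Measure (TreeBoundary K)) :
    ∫⁻ ξ, (∫⁻ t in Set.Ioi 0, h (TreeBoundary.ray ε ξ t) * radialWeight a l C t) ∂ν =
      ∑' e : List (Fin K) × Fin K, ν (TreeBoundary.cylinder (e.1 ++ [e.2])) *
        ∫⁻ t in Set.Ioc (e.1.length : ℝ) (e.1.length + 1),
          h ((vertex ε (e.1 ++ [e.2])).anc t) * radialWeight a l C t := by
  have e1 : ∀ ξ : TreeBoundary K,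
      ∫⁻ t in Set.Ioi 0, h (TreeBoundary.ray ε ξ t) * radialWeight a l C t =
      ∫⁻ t in Set.Ioi 0, (fun x => h x * radialWeight a l C x.height) (TreeBoundary.ray ε ξ t) :=
    fun ξ => setLIntegral_congr_fun measurableSet_Ioi fun t ht => by
      simp only [TreeBoundary.ray_height ξ (le_of_lt (Set.mem_Ioi.1 ht))]
  rw [lintegral_congr e1,
    lintegral_lintegral_ray (h := fun x => h x * radialWeight a l C x.height)]
  congr 1 with e
  congr 1
  refine setLIntegral_congr_fun measurableSet_Ioc fun t ht => ?_
  have : ((vertex ε (e.1 ++ [e.2])).anc t).height = t :=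
    anc_height _ ((Nat.cast_nonneg _).trans ht.1.le) (by simpa [vertex] using ht.2)
  simp only [this]

/-- Up to constants, integration against `μ_l` is integration over all rays with respect to `ν`
and the weight `e^{-(β - log K) t} (t + C)^l` along each ray: an edge at height `t` carries a share
comparable to `e^{-t log K}` of the boundary. -/
theorem lintegral_weightedMeasure_comparable (hK : 2 ≤ K) (hε : 0 < ε) (β : ℝ)
    {ν : Measure (TreeBoundary K)} (hν : TreeBoundary.AhlforsRegular ε (Real.log K / ε) ν) :
    ∃ A : ℝ≥0∞, A ≠ ∞ ∧ ∀ (l C : ℝ) (h : RegularTree K ε → ℝ≥0∞), Measurable h →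
      (∫⁻ ξ, (∫⁻ t in Set.Ioi 0,
          h (TreeBoundary.ray ε ξ t) * radialWeight (β - Real.log K) l C t) ∂ν ≤
        A * ∫⁻ x, h x ∂weightedMeasure K ε β l C) ∧
      (∫⁻ x, h x ∂weightedMeasure K ε β l C ≤
        A * ∫⁻ ξ, (∫⁻ t in Set.Ioi 0,
          h (TreeBoundary.ray ε ξ t) * radialWeight (β - Real.log K) l C t) ∂ν) := by
  obtain ⟨a, b, ha, hb, hab⟩ := hν.measure_cylinder hK hε
  have hK0 : (0 : ℝ) < K := by positivity
  have hL : 0 ≤ Real.log K := Real.log_natCast_nonneg K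
  refine ⟨ENNReal.ofReal (max b (K / a)), ENNReal.ofReal_ne_top, fun l C h hh => ?_⟩
  rw [lintegral_weightedMeasure hε β l C hh, lintegral_lintegral_ray_radialWeight,
    ← ENNReal.tsum_mul_left, ← ENNReal.tsum_mul_left]
  refine ⟨ENNReal.tsum_le_tsum fun e => ?_, ENNReal.tsum_le_tsum fun e => ?_⟩
  · rw [← lintegral_const_mul' _ _ ENNReal.ofReal_ne_top]
    refine (mul_le_mul_left (hab (e.1 ++ [e.2]) (by simp)).2 _).trans ?_
    rw [← lintegral_const_mul' _ _ ENNReal.ofReal_ne_top]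
    refine setLIntegral_mono' measurableSet_Ioc fun t ht => ?_
    rw [radialWeight_eq_mul β (Real.log K), mul_comm (radialWeight _ _ _ _) (ENNReal.ofReal _),
      mul_left_comm (h _), ← mul_assoc (ENNReal.ofReal _) (ENNReal.ofReal _),
      ← ENNReal.ofReal_mul (by positivity)]
    refine mul_le_mul_left (ENNReal.ofReal_le_ofReal ?_) _
    refine mul_le_mul (le_max_left _ _) (Real.exp_le_exp.2 ?_) (Real.exp_pos _).le (by positivity)
    have := mul_le_mul_of_nonneg_left ht.2 hL
    simp only [List.length_append, List.length_singleton]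
    push_cast
    linarith
  · rw [← mul_assoc, ← lintegral_const_mul' _ _ (ENNReal.mul_ne_top ENNReal.ofReal_ne_top
      ((hab (e.1 ++ [e.2]) (by simp)).2.trans_lt ENNReal.ofReal_lt_top).ne)]
    refine setLIntegral_mono' measurableSet_Ioc fun t ht => ?_
    rw [radialWeight_eq_mul β (Real.log K), mul_comm (radialWeight _ _ _ _) (ENNReal.ofReal _),
      mul_left_comm (h _)]
    refine mul_le_mul_left ?_ _
    refine le_trans ?_ (mul_le_mul_right (hab (e.1 ++ [e.2]) (by simp)).1 _)
    rw [← ENNReal.ofReal_mul (by positivity)]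
    refine ENNReal.ofReal_le_ofReal ?_
    have h1 : Real.exp (-Real.log K * t) ≤
        K * Real.exp (-Real.log K * (e.1 ++ [e.2]).length) := by
      nth_rewrite 2 [← Real.exp_log hK0]
      rw [← Real.exp_add, Real.exp_le_exp]
      have := mul_le_mul_of_nonneg_left ht.1.le hL
      simp only [List.length_append, List.length_singleton]
      push_cast
      linarith
    calc _ ≤ K / a * (a * Real.exp (-Real.log K * (e.1 ++ [e.2]).length)) := by
          rw [← mul_assoc, div_mul_cancel₀ _ ha.ne']; exact h1
      _ ≤ _ := mul_le_mul_of_nonneg_right (le_max_right _ _) (by positivity)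

/-- A null set of the tree is met by almost every ray in a set of heights of measure zero. -/
theorem ae_ae_ray_of_ae (hK : 2 ≤ K) (hε : 0 < ε) (β : ℝ) {l C : ℝ} (hC : 0 < C)
    {ν : Measure (TreeBoundary K)} (hν : TreeBoundary.AhlforsRegular ε (Real.log K / ε) ν)
    {P : RegularTree K ε → Prop} (hP : ∀ᵐ x ∂weightedMeasure K ε β l C, P x) :
    ∀ᵐ ξ ∂ν, ∀ᵐ t ∂volume.restrict (Set.Ioi (0 : ℝ)), P (TreeBoundary.ray ε ξ t) := by
  obtain ⟨A, hA, h⟩ := lintegral_weightedMeasure_comparable hK hε β hν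
  set N := toMeasurable (weightedMeasure K ε β l C) {x | ¬ P x}
  have hN : MeasurableSet N := measurableSet_toMeasurable _ _
  have hN0 : weightedMeasure K ε β l C N = 0 := by
    rw [measure_toMeasurable]; exact hP
  have h1 := (h l C (N.indicator 1) (measurable_one.indicator hN)).1
  rw [lintegral_indicator_one hN, hN0, mul_zero, nonpos_iff_eq_zero] at h1
  have hm : Measurable fun q : TreeBoundary K × ℝ =>
      N.indicator (1 : RegularTree K ε → ℝ≥0∞) (TreeBoundary.ray ε q.1 q.2) *
        radialWeight (β - Real.log K) l C q.2 :=
    ((measurable_one.indicator hN).comp measurable_ray).mul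
      ((measurable_radialWeight _ _ _).comp measurable_snd)
  rw [lintegral_eq_zero_iff hm.lintegral_prod_right'] at h1
  filter_upwards [h1] with ξ hξ
  have h2 := (lintegral_eq_zero_iff (hm.comp measurable_prodMk_left)).1 hξ
  filter_upwards [h2, ae_restrict_mem measurableSet_Ioi] with t ht ht0
  by_contra hPt
  have : TreeBoundary.ray ε ξ t ∈ N := subset_toMeasurable _ _ hPt
  have ht0' : 0 < t + C := add_pos ht0 hC
  simp only [Function.comp, Set.indicator_of_mem this, Pi.one_apply, one_mul, Pi.zero_apply,
    radialWeight, ENNReal.ofReal_eq_zero] at ht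
  exact absurd ht (not_le.2 (by positivity))

theorem lintegral_radialWeight_lt_top {a C : ℝ} (ha : 0 < a) (hC : 0 < C) (l : ℝ) :
    ∫⁻ t in Set.Ioi 0, radialWeight a l C t < ∞ := by
  have hcont : ContinuousOn (fun t : ℝ => Real.exp (-a * t) * (t + C) ^ l) (Set.Ici 0) := by
    refine ContinuousOn.mul (by fun_prop) (ContinuousOn.rpow_const (by fun_prop) fun t ht => ?_)
    exact Or.inl (add_pos_of_nonneg_of_pos ht hC).ne'
  have ho : (fun t : ℝ => Real.exp (-a * t) * (t + C) ^ l) =O[atTop]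
      fun t => Real.exp (-(a / 2) * t) := by
    have h1 : (fun t : ℝ => (t + C) ^ l) =O[atTop] fun t => Real.exp (a / 2 * (t + C)) :=
      ((isLittleO_rpow_exp_pos_mul_atTop l (half_pos ha)).comp_tendsto
        (tendsto_atTop_add_const_right _ C tendsto_id)).isBigO
    refine ((Asymptotics.isBigO_refl (fun t : ℝ => Real.exp (-a * t)) atTop).mul h1).trans ?_
    refine Asymptotics.IsBigO.of_bound (Real.exp (a / 2 * C)) (Eventually.of_forall fun t => ?_)
    rw [← Real.exp_add, Real.norm_of_nonneg (Real.exp_pos _).le,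
      Real.norm_of_nonneg (Real.exp_pos _).le, ← Real.exp_add]
    apply le_of_eq
    ring_nf
  exact (integrable_of_isBigO_exp_neg (half_pos ha) hcont ho).lintegral_lt_top

theorem lintegral_radialWeight_pos (a : ℝ) {C : ℝ} (hC : 0 < C) (l : ℝ) :
    ∫⁻ t in Set.Ioi 0, radialWeight a l C t ≠ 0 := by
  intro h
  rw [lintegral_eq_zero_iff (measurable_radialWeight a l C)] at h
  have : ∀ᵐ t ∂volume.restrict (Set.Ioi (0 : ℝ)), False := by
    filter_upwards [h, ae_restrict_mem measurableSet_Ioi] with t ht ht0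
    have ht0' : 0 < t + C := add_pos ht0 hC
    simp only [Pi.zero_apply, radialWeight, ENNReal.ofReal_eq_zero] at ht
    exact absurd ht (not_le.2 (by positivity))
  rw [ae_iff] at this
  simp at this

theorem isFiniteMeasure_weightedMeasure (hK : 2 ≤ K) (hε : 0 < ε) {β C : ℝ}
    (hβ : Real.log K < β) (hC : 0 < C) (l : ℝ)
    {ν : Measure (TreeBoundary K)} (hν : TreeBoundary.AhlforsRegular ε (Real.log K / ε) ν) :
    IsFiniteMeasure (weightedMeasure K ε β l C) := by
  have := hν.isFiniteMeasure hK hε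
  obtain ⟨A, hA, h⟩ := lintegral_weightedMeasure_comparable hK hε β hν
  have h1 := (h l C 1 measurable_one).2
  simp only [Pi.one_apply, one_mul, lintegral_const] at h1
  refine ⟨h1.trans_lt (ENNReal.mul_lt_top hA.lt_top (ENNReal.mul_lt_top
    (lintegral_radialWeight_lt_top (sub_pos.2 hβ) hC l) (measure_lt_top _ _)))⟩

/-- For a finite measure the local integrability required of Newtonian functions is automatic. -/
theorem mem_newtonianSpace {p : ℝ} (hp : 1 ≤ p) {μ : Measure (RegularTree K ε)} [IsFiniteMeasure μ]
    {u : RegularTree K ε → ℝ} {g : RegularTree K ε → ℝ≥0∞} (hu : Measurable u)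
    (hup : ∫⁻ x, ‖u x‖ₑ ^ p ∂μ < ∞) (hg : IsUpperGradient g u) (hgp : ∫⁻ x, g x ^ p ∂μ < ∞) :
    u ∈ newtonianSpace p hp μ := by
  have hp0 : 0 < p := by linarith
  refine ⟨Integrable.locallyIntegrable ?_, (newtonianENorm_lt_top_iff hp μ u).2 ⟨hup, g, hg, hgp⟩⟩
  have hm : MemLp u (ENNReal.ofReal p) μ := by
    refine ⟨hu.aestronglyMeasurable, ?_⟩
    rw [eLpNorm_lt_top_iff_lintegral_rpow_enorm_lt_top (by simpa using hp0) (by simp),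
      ENNReal.toReal_ofReal hp0.le]
    exact hup
  exact hm.integrable (by rw [ENNReal.one_le_ofReal]; exact hp)

theorem newtonianENorm_le {p : ℝ} {μ : Measure (RegularTree K ε)} (hp : 1 ≤ p)
    {u : RegularTree K ε → ℝ} {g : RegularTree K ε → ℝ≥0∞} (hg : IsUpperGradient g u) :
    newtonianENorm p μ u ≤ ((∫⁻ x, ‖u x‖ₑ ^ p ∂μ) + ∫⁻ x, g x ^ p ∂μ) ^ (1 / p) :=
  ENNReal.rpow_le_rpow (add_le_add le_rfl (iInf₂_le g hg)) (by positivity)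

end RegularTree

/-! ### The trace operator -/

namespace RegularTree

variable {K : ℕ} {ε : ℝ}

/-- A weighted Hölder inequality: for `p > 1` the condition `p - 1 < l` makes the dual weight
`(t + C) ^ (-l / (p - 1))` integrable, and for `p = 1` the weight is bounded below. -/
theorem exists_rpow_lintegral_le {p l C : ℝ} (hp : 1 ≤ p) (hC : 0 < C)
    (h1 : 1 < p → p - 1 < l) (h2 : p = 1 → 0 ≤ l) :
    ∃ A : ℝ≥0∞, A ≠ ∞ ∧ ∀ h : ℝ → ℝ≥0∞, Measurable h →
      (∫⁻ t in Set.Ioi 0, h t) ^ p ≤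
        A * ∫⁻ t in Set.Ioi 0, h t ^ p * ENNReal.ofReal ((t + C) ^ l) := by
  have hpos : ∀ t ∈ Set.Ioi (0 : ℝ), 0 < t + C := fun t ht => add_pos ht hC
  rcases hp.eq_or_lt with rfl | hp1
  · refine ⟨ENNReal.ofReal (C ^ (-l)), ENNReal.ofReal_ne_top, fun h hh => ?_⟩
    rw [ENNReal.rpow_one, ← lintegral_const_mul' _ _ ENNReal.ofReal_ne_top]
    refine setLIntegral_mono' measurableSet_Ioi fun t ht => ?_
    rw [ENNReal.rpow_one, mul_left_comm, ← ENNReal.ofReal_mul (by positivity)]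
    refine le_mul_of_one_le_right (zero_le) ?_
    rw [ENNReal.one_le_ofReal, Real.rpow_neg hC.le, ← div_eq_inv_mul, one_le_div (by positivity)]
    exact Real.rpow_le_rpow hC.le (by linarith [Set.mem_Ioi.1 ht]) (h2 rfl)
  · have hp0 : 0 < p := by linarith
    have hpq : p.HolderConjugate p.conjExponent := Real.HolderConjugate.conjExponent hp1
    set q := p.conjExponent with hq
    set J := ∫⁻ t in Set.Ioi (0 : ℝ), ENNReal.ofReal ((t + C) ^ (-l / p)) ^ q with hJ
    have hJtop : J < ∞ := by
      have e : J = ∫⁻ t in Set.Ioi (0 : ℝ), ENNReal.ofReal ((t + C) ^ (-l / (p - 1))) := by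
        refine setLIntegral_congr_fun measurableSet_Ioi fun t ht => ?_
        have := hpos t ht
        rw [ENNReal.ofReal_rpow_of_pos (by positivity), ← Real.rpow_mul this.le, hq,
          Real.conjExponent]
        congr 2
        field_simp
      rw [e]
      refine (integrableOn_add_rpow_Ioi_of_lt ?_ (by linarith)).lintegral_lt_top
      rw [neg_div, neg_lt_neg_iff, one_lt_div (by linarith)]
      exact h1 hp1
    refine ⟨(J ^ (1 / q)) ^ p, ?_, fun h hh => ?_⟩
    · exact ENNReal.rpow_ne_top_of_nonneg hp0.le
        (ENNReal.rpow_ne_top_of_nonneg (by have := hpq.symm.pos; positivity) hJtop.ne)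
    · have hol := ENNReal.lintegral_mul_le_Lp_mul_Lq (volume.restrict (Set.Ioi (0 : ℝ))) hpq
        (f := fun t => h t * ENNReal.ofReal ((t + C) ^ (l / p)))
        (g := fun t => ENNReal.ofReal ((t + C) ^ (-l / p))) (by fun_prop) (by fun_prop)
      have e1 : ∫⁻ t in Set.Ioi (0 : ℝ), ((fun t => h t * ENNReal.ofReal ((t + C) ^ (l / p))) *
          fun t => ENNReal.ofReal ((t + C) ^ (-l / p))) t = ∫⁻ t in Set.Ioi 0, h t := by
        refine setLIntegral_congr_fun measurableSet_Ioi fun t ht => ?_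
        have := hpos t ht
        simp only [Pi.mul_apply]
        rw [mul_assoc, ← ENNReal.ofReal_mul (by positivity), ← Real.rpow_add this, neg_div,
          add_neg_cancel, Real.rpow_zero, ENNReal.ofReal_one, mul_one]
      have e2 : ∫⁻ t in Set.Ioi (0 : ℝ), (h t * ENNReal.ofReal ((t + C) ^ (l / p))) ^ p =
          ∫⁻ t in Set.Ioi (0 : ℝ), h t ^ p * ENNReal.ofReal ((t + C) ^ l) := by
        refine setLIntegral_congr_fun measurableSet_Ioi fun t ht => ?_
        have := hpos t ht
        rw [ENNReal.mul_rpow_of_nonneg _ _ hp0.le, ENNReal.ofReal_rpow_of_pos (by positivity),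
          ← Real.rpow_mul this.le, div_mul_cancel₀ _ hp0.ne']
      rw [e1, e2] at hol
      refine (ENNReal.rpow_le_rpow hol hp0.le).trans_eq ?_
      rw [ENNReal.mul_rpow_of_nonneg _ _ hp0.le, ← ENNReal.rpow_mul, one_div_mul_cancel hp0.ne',
        ENNReal.rpow_one, mul_comm]

/-- The integral of `g` along the whole geodesic ray to `ξ`. -/
noncomputable def rayIntegral (g : RegularTree K ε → ℝ≥0∞) (ξ : TreeBoundary K) : ℝ≥0∞ :=
  ∫⁻ t in Set.Ioi 0, g (TreeBoundary.ray ε ξ t) * ENNReal.ofReal (Real.exp (-ε * t))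

theorem measurable_rayIntegral {g : RegularTree K ε → ℝ≥0∞} (hg : Measurable g) :
    Measurable (rayIntegral g) := by
  refine Measurable.lintegral_prod_right' (f := fun q : TreeBoundary K × ℝ =>
    g (TreeBoundary.ray ε q.1 q.2) * ENNReal.ofReal (Real.exp (-ε * q.2))) ?_
  exact (hg.comp measurable_ray).mul (by fun_prop)

theorem IsUpperGradient.le_setLIntegral_ray {g : RegularTree K ε → ℝ≥0∞}
    {u : RegularTree K ε → ℝ} (hg : IsUpperGradient g u) (ξ : TreeBoundary K) {s t : ℝ}
    (hs : 0 ≤ s) (hst : s ≤ t) :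
    ENNReal.ofReal |u (TreeBoundary.ray ε ξ s) - u (TreeBoundary.ray ε ξ t)| ≤
      ∫⁻ r in Set.Ioc s t,
        g (TreeBoundary.ray ε ξ r) * ENNReal.ofReal (Real.exp (-ε * r)) := by
  have ht := hs.trans hst
  have h := hg.2 (TreeBoundary.ray ε ξ s) (TreeBoundary.ray ε ξ t)
  have hh : (TreeBoundary.ray ε ξ t).height = t := TreeBoundary.ray_height ξ ht
  rw [← TreeBoundary.anc_ray ξ hs hst, pathIntegral_anc_left g _ hs (hst.trans_eq hh.symm), hh,
    TreeBoundary.anc_ray ξ hs hst] at h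
  refine h.trans_eq (setLIntegral_congr_fun measurableSet_Ioc fun r hr => ?_)
  rw [TreeBoundary.anc_ray ξ (hs.trans hr.1.le) hr.2]

/-- A function has a limit along every ray on which it has an integrable upper gradient. -/
theorem IsUpperGradient.exists_tendsto_ray {g : RegularTree K ε → ℝ≥0∞}
    {u : RegularTree K ε → ℝ} (hg : IsUpperGradient g u) (ξ : TreeBoundary K)
    (hξ : rayIntegral g ξ < ∞) :
    ∃ L, Tendsto (fun t : ℝ => u (TreeBoundary.ray ε ξ t)) atTop (𝓝 L) := by
  set φ : ℝ → ℝ≥0∞ := fun r => g (TreeBoundary.ray ε ξ r) * ENNReal.ofReal (Real.exp (-ε * r))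
  have hfin : ∀ s t : ℝ, 0 ≤ s → ∫⁻ r in Set.Ioc s t, φ r ≠ ∞ := fun s t hs =>
    ((lintegral_mono_set fun r hr => hs.trans_lt hr.1).trans_lt hξ).ne
  set Φ : ℝ → ℝ := fun t => (∫⁻ r in Set.Ioc 0 t, φ r).toReal
  have hmono : Monotone Φ := fun s t hst => ENNReal.toReal_mono (hfin 0 t le_rfl)
    (lintegral_mono_set (Set.Ioc_subset_Ioc_right hst))
  have hbdd : BddAbove (Set.range Φ) := ⟨(rayIntegral g ξ).toReal, by
    rintro _ ⟨t, rfl⟩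
    exact ENNReal.toReal_mono hξ.ne (lintegral_mono_set fun r hr => hr.1)⟩
  have hΦ : CauchySeq Φ := (tendsto_atTop_ciSup hmono hbdd).cauchySeq
  have hle : ∀ s t : ℝ, 0 ≤ s → s ≤ t →
      dist (u (TreeBoundary.ray ε ξ s)) (u (TreeBoundary.ray ε ξ t)) ≤ dist (Φ s) (Φ t) := by
    intro s t hs hst
    have h := hg.le_setLIntegral_ray ξ hs hst
    have hadd : ∫⁻ r in Set.Ioc 0 t, φ r =
        (∫⁻ r in Set.Ioc 0 s, φ r) + ∫⁻ r in Set.Ioc s t, φ r := by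
      rw [← Set.Ioc_union_Ioc_eq_Ioc hs hst,
        lintegral_union measurableSet_Ioc (Set.Ioc_disjoint_Ioc_of_le le_rfl)]
    rw [dist_comm (Φ s), Real.dist_eq, Real.dist_eq, abs_of_nonneg (sub_nonneg.2 (hmono hst))]
    simp only [Φ]
    rw [hadd, ENNReal.toReal_add (hfin 0 s le_rfl) (hfin s t hs), add_sub_cancel_left]
    exact (ENNReal.ofReal_le_iff_le_toReal (hfin s t hs)).1 h
  refine cauchySeq_tendsto_of_complete (Metric.cauchySeq_iff.2 fun η hη => ?_)
  obtain ⟨N, hN⟩ := Metric.cauchySeq_iff.1 hΦ η hη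
  refine ⟨max N 0, fun s hs t ht => ?_⟩
  have hs' := max_le_iff.1 (ge_iff_le.1 hs)
  have ht' := max_le_iff.1 (ge_iff_le.1 ht)
  rcases le_total s t with hst | hts
  · exact (hle s t hs'.2 hst).trans_lt (hN s hs'.1 t ht'.1)
  · rw [dist_comm]
    exact (hle t s ht'.2 hts).trans_lt (hN t ht'.1 s hs'.1)

theorem IsUpperGradient.enorm_limit_le {g : RegularTree K ε → ℝ≥0∞}
    {u : RegularTree K ε → ℝ} (hg : IsUpperGradient g u) (ξ : TreeBoundary K) {L : ℝ}
    (hL : Tendsto (fun t : ℝ => u (TreeBoundary.ray ε ξ t)) atTop (𝓝 L)) {t : ℝ} (ht : 0 ≤ t) :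
    ‖L‖ₑ ≤ ‖u (TreeBoundary.ray ε ξ t)‖ₑ + rayIntegral g ξ := by
  refine le_of_tendsto hL.enorm ?_
  filter_upwards [eventually_ge_atTop t] with s hs
  have h := hg.le_setLIntegral_ray ξ ht hs
  rw [← Real.enorm_eq_ofReal_abs] at h
  have h1 : ‖u (TreeBoundary.ray ε ξ s)‖ₑ ≤ ‖u (TreeBoundary.ray ε ξ t)‖ₑ +
      ‖u (TreeBoundary.ray ε ξ t) - u (TreeBoundary.ray ε ξ s)‖ₑ := by
    have := enorm_sub_le (E := ℝ) (a := u (TreeBoundary.ray ε ξ t))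
      (b := u (TreeBoundary.ray ε ξ t) - u (TreeBoundary.ray ε ξ s))
    rwa [sub_sub_cancel] at this
  refine h1.trans (add_le_add le_rfl (h.trans ?_))
  exact lintegral_mono_set fun r hr => ht.trans_lt hr.1

/-- The exponent `p = (β - log K) / ε` is the one for which the factor `e^{-εpt}` produced by
Hölder's inequality on a ray is exactly the weight of the ray in `μ_l`. -/
theorem exists_lintegral_rayIntegral_rpow_le (hK : 2 ≤ K) (hε : 0 < ε) {β p l C : ℝ}
    (hp_eq : p = (β - Real.log K) / ε) (hp : 1 ≤ p) (hC : 0 < C)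
    (h1 : 1 < p → p - 1 < l) (h2 : p = 1 → 0 ≤ l)
    {ν : Measure (TreeBoundary K)} (hν : TreeBoundary.AhlforsRegular ε (Real.log K / ε) ν) :
    ∃ A : ℝ≥0∞, A ≠ ∞ ∧ ∀ g : RegularTree K ε → ℝ≥0∞, Measurable g →
      ∫⁻ ξ, rayIntegral g ξ ^ p ∂ν ≤ A * ∫⁻ x, g x ^ p ∂weightedMeasure K ε β l C := by
  obtain ⟨A, hA, hAh⟩ := lintegral_weightedMeasure_comparable hK hε β hν
  obtain ⟨B, hB, hBh⟩ := exists_rpow_lintegral_le hp hC h1 h2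
  have hp0 : 0 ≤ p := by linarith
  refine ⟨B * A, ENNReal.mul_ne_top hB hA, fun g hg => ?_⟩
  have key : ∀ ξ, rayIntegral g ξ ^ p ≤ B * ∫⁻ t in Set.Ioi 0,
      g (TreeBoundary.ray ε ξ t) ^ p * radialWeight (β - Real.log K) l C t := by
    intro ξ
    refine (hBh _ ?_).trans_eq ?_
    · exact (hg.comp (measurable_ray.comp measurable_prodMk_left)).mul (by fun_prop)
    · congr 1
      refine setLIntegral_congr_fun measurableSet_Ioi fun t ht => ?_
      have : 0 < t + C := add_pos ht hC
      rw [ENNReal.mul_rpow_of_nonneg _ _ hp0, mul_assoc,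
        ENNReal.ofReal_rpow_of_pos (Real.exp_pos _), ← ENNReal.ofReal_mul (by positivity),
        ← Real.exp_mul, radialWeight]
      have e : -ε * t * p = -(β - Real.log K) * t := by rw [hp_eq]; field_simp
      rw [e]
  refine (lintegral_mono key).trans ?_
  rw [lintegral_const_mul' _ _ hB, mul_assoc]
  exact mul_le_mul_right (hAh l C _ (hg.pow_const p)).1 _

/-- The boundary limit is bounded in `L^p` by the function and any upper gradient: the inequality
`|f(ξ)| ≤ |u(x)| + ∫_{[0, ξ)} g ds` is averaged over the points `x` of the ray. -/
theorem exists_lintegral_limit_le (hK : 2 ≤ K) (hε : 0 < ε) {β p l C : ℝ}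
    (hβ : Real.log K < β)
    (hp_eq : p = (β - Real.log K) / ε) (hp : 1 ≤ p) (hC : 0 < C)
    (h1 : 1 < p → p - 1 < l) (h2 : p = 1 → 0 ≤ l)
    {ν : Measure (TreeBoundary K)} (hν : TreeBoundary.AhlforsRegular ε (Real.log K / ε) ν) :
    ∃ A : ℝ≥0∞, A ≠ ∞ ∧ ∀ (u : RegularTree K ε → ℝ) (g : RegularTree K ε → ℝ≥0∞)
      (f : TreeBoundary K → ℝ), AEStronglyMeasurable u (weightedMeasure K ε β l C) →
      IsUpperGradient g u →
      (∀ᵐ ξ ∂ν, Tendsto (fun t : ℝ => u (TreeBoundary.ray ε ξ t)) atTop (𝓝 (f ξ))) →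
      ∫⁻ ξ, ‖f ξ‖ₑ ^ p ∂ν ≤ A * ((∫⁻ x, ‖u x‖ₑ ^ p ∂weightedMeasure K ε β l C) +
        ∫⁻ x, g x ^ p ∂weightedMeasure K ε β l C) := by
  obtain ⟨A, hA, hAh⟩ := lintegral_weightedMeasure_comparable hK hε β hν
  obtain ⟨B, hB, hBh⟩ := exists_lintegral_rayIntegral_rpow_le hK hε hp_eq hp hC h1 h2 hν
  have hp0 : 0 ≤ p := by linarith
  set W := ∫⁻ t in Set.Ioi 0, radialWeight (β - Real.log K) l C t with hW
  have hWtop : W ≠ ∞ := (lintegral_radialWeight_lt_top (sub_pos.2 hβ) hC l).ne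
  have hW0 : W ≠ 0 := lintegral_radialWeight_pos _ hC l
  have h2p : (2 : ℝ≥0∞) ^ (p - 1) ≠ ∞ := ENNReal.rpow_ne_top_of_nonneg (by linarith) (by simp)
  refine ⟨W⁻¹ * (2 ^ (p - 1) * (A + W * B)), ?_, fun u g f hu hg hf => ?_⟩
  · exact ENNReal.mul_ne_top (ENNReal.inv_ne_top.2 hW0) (ENNReal.mul_ne_top h2p
      (ENNReal.add_ne_top.2 ⟨hA, ENNReal.mul_ne_top hWtop hB⟩))
  set μ := weightedMeasure K ε β l C
  obtain ⟨v, hv, huv⟩ := hu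
  have hvm : Measurable fun x => ‖v x‖ₑ ^ p := hv.measurable.enorm.pow_const p
  have hvint : ∫⁻ x, ‖u x‖ₑ ^ p ∂μ = ∫⁻ x, ‖v x‖ₑ ^ p ∂μ :=
    lintegral_congr_ae (huv.mono fun x hx => by simp only [hx])
  have hwm := measurable_radialWeight (β - Real.log K) l C
  -- `|f(ξ)| ≤ |v(ray ξ t)| + rayIntegral g ξ` for almost every `t`, integrated against the weight
  have key : ∀ᵐ ξ ∂ν, W * ‖f ξ‖ₑ ^ p ≤ 2 ^ (p - 1) * ((∫⁻ t in Set.Ioi 0,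
      ‖v (TreeBoundary.ray ε ξ t)‖ₑ ^ p * radialWeight (β - Real.log K) l C t) +
      W * rayIntegral g ξ ^ p) := by
    filter_upwards [hf, ae_ae_ray_of_ae hK hε β hC hν huv] with ξ hξ hξv
    rw [hW, mul_comm, mul_comm (∫⁻ t in Set.Ioi 0, _) (rayIntegral g ξ ^ p),
      ← lintegral_const_mul _ hwm, ← lintegral_const_mul _ hwm,
      ← lintegral_add_right _ (hwm.const_mul _), ← lintegral_const_mul' _ _ h2p]
    refine lintegral_mono_ae ?_
    filter_upwards [hξv, ae_restrict_mem measurableSet_Ioi] with t ht ht0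
    rw [← add_mul, ← mul_assoc, ← ht]
    refine mul_le_mul_left ?_ _
    exact (ENNReal.rpow_le_rpow (hg.enorm_limit_le ξ hξ (le_of_lt ht0)) hp0).trans
      (ENNReal.rpow_add_le_mul_rpow_add_rpow _ _ hp)
  have hfin : W * ∫⁻ ξ, ‖f ξ‖ₑ ^ p ∂ν ≤
      2 ^ (p - 1) * (A * (∫⁻ x, ‖v x‖ₑ ^ p ∂μ) + W * (B * ∫⁻ x, g x ^ p ∂μ)) := by
    rw [← lintegral_const_mul' _ _ hWtop]
    refine (lintegral_mono_ae key).trans ?_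
    rw [lintegral_const_mul' _ _ h2p,
      lintegral_add_right _ (((measurable_rayIntegral hg.1).pow_const p).const_mul W),
      lintegral_const_mul' _ _ hWtop]
    exact mul_le_mul_right (add_le_add (hAh l C _ hvm).1 (mul_le_mul_right (hBh g hg.1) _)) _
  rw [hvint]
  calc ∫⁻ ξ, ‖f ξ‖ₑ ^ p ∂ν = W⁻¹ * (W * ∫⁻ ξ, ‖f ξ‖ₑ ^ p ∂ν) := by
        rw [← mul_assoc, ENNReal.inv_mul_cancel hW0 hWtop, one_mul]
    _ ≤ W⁻¹ * (2 ^ (p - 1) * (A * (∫⁻ x, ‖v x‖ₑ ^ p ∂μ) + W * (B * ∫⁻ x, g x ^ p ∂μ))) :=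
        mul_le_mul_right hfin _
    _ ≤ W⁻¹ * (2 ^ (p - 1) * ((A + W * B) * ((∫⁻ x, ‖v x‖ₑ ^ p ∂μ) + ∫⁻ x, g x ^ p ∂μ))) := by
        refine mul_le_mul_right (mul_le_mul_right ?_ _) _
        rw [add_mul, ← mul_assoc W]
        exact add_le_add (mul_le_mul_right le_self_add _) (mul_le_mul_right le_add_self _)
    _ = _ := by simp only [mul_assoc]

theorem le_mul_newtonianENorm_rpow {p : ℝ} (hp : 1 ≤ p) {μ : Measure (RegularTree K ε)}
    {u : RegularTree K ε → ℝ} {A X : ℝ≥0∞} (hA0 : A ≠ 0) (hA : A ≠ ∞)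
    (h : ∀ g, IsUpperGradient g u → X ≤ A * ((∫⁻ x, ‖u x‖ₑ ^ p ∂μ) + ∫⁻ x, g x ^ p ∂μ)) :
    X ≤ A * newtonianENorm p μ u ^ p := by
  rw [newtonianENorm, ← ENNReal.rpow_mul, one_div_mul_cancel (by linarith), ENNReal.rpow_one,
    ← ENNReal.div_le_iff' hA0 hA, ← tsub_le_iff_left]
  refine le_iInf₂ fun g hg => ?_
  rw [tsub_le_iff_left, ENNReal.div_le_iff' hA0 hA]
  exact h g hg

/-- The trace of one function, with a constant that does not depend on the function. -/
theorem exists_trace (hK : 2 ≤ K) (hε : 0 < ε) {β p l C : ℝ} (hβ : Real.log K < β)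
    (hp_eq : p = (β - Real.log K) / ε) (hp : 1 ≤ p) (hC : 0 < C)
    (h1 : 1 < p → p - 1 < l) (h2 : p = 1 → 0 ≤ l)
    {ν : Measure (TreeBoundary K)} (hν : TreeBoundary.AhlforsRegular ε (Real.log K / ε) ν) :
    ∃ A : ℝ, 0 ≤ A ∧ ∀ u : newtonianSpace p hp (weightedMeasure K ε β l C),
      ∃ f : Lp ℝ (ENNReal.ofReal p) ν,
        (∀ᵐ ξ ∂ν, Tendsto (fun t : ℝ => (u : RegularTree K ε → ℝ) (TreeBoundary.ray ε ξ t))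
            atTop (𝓝 (f ξ))) ∧
        ‖f‖ ≤ A * newtonianNorm p (weightedMeasure K ε β l C) u := by
  obtain ⟨A, hA, hAh⟩ := exists_lintegral_limit_le hK hε hβ hp_eq hp hC h1 h2 hν
  obtain ⟨B, hB, hBh⟩ := exists_lintegral_rayIntegral_rpow_le hK hε hp_eq hp hC h1 h2 hν
  have hp0 : 0 < p := by linarith
  -- a nonzero constant is needed to pass to the infimum over upper gradients
  set A' : ℝ≥0∞ := A + 1 with hA'
  have hA'top : A' ≠ ∞ := ENNReal.add_ne_top.2 ⟨hA, by simp⟩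
  have hA'0 : A' ≠ 0 := by simp [hA']
  refine ⟨(A' ^ (1 / p)).toReal, ENNReal.toReal_nonneg, fun ⟨u, hu⟩ => ?_⟩
  obtain ⟨-, g, hg, hgint⟩ := (newtonianENorm_lt_top_iff hp _ u).1 hu.2
  have hfin : ∀ᵐ ξ ∂ν, rayIntegral g ξ < ∞ := by
    have := ae_lt_top ((measurable_rayIntegral hg.1).pow_const p)
      ((hBh g hg.1).trans_lt (ENNReal.mul_lt_top hB.lt_top hgint)).ne
    filter_upwards [this] with ξ hξ
    exact (ENNReal.rpow_lt_top_iff_of_pos hp0).1 hξ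
  have hlim : ∀ᵐ ξ ∂ν, ∃ L, Tendsto (fun t : ℝ => u (TreeBoundary.ray ε ξ t)) atTop (𝓝 L) :=
    hfin.mono fun ξ hξ => hg.exists_tendsto_ray ξ hξ
  have hmeas : ∀ n : ℕ, AEStronglyMeasurable (fun ξ => u (TreeBoundary.ray ε ξ (n : ℝ))) ν := by
    intro n
    simp only [TreeBoundary.ray_natCast]
    exact (TreeBoundary.measurable_comp_prefixWord
      (fun w => u (vertex ε w)) n).aestronglyMeasurable
  obtain ⟨f, hfm, hf⟩ := exists_stronglyMeasurable_limit_of_tendsto_ae hmeas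
    (hlim.mono fun ξ ⟨L, hL⟩ => ⟨L, hL.comp tendsto_natCast_atTop_atTop⟩)
  have hfu : ∀ᵐ ξ ∂ν, Tendsto (fun t : ℝ => u (TreeBoundary.ray ε ξ t)) atTop (𝓝 (f ξ)) := by
    filter_upwards [hf, hlim] with ξ hξ ⟨L, hL⟩
    rwa [tendsto_nhds_unique hξ (hL.comp tendsto_natCast_atTop_atTop)]
  have hbound : ∫⁻ ξ, ‖f ξ‖ₑ ^ p ∂ν ≤
      A' * newtonianENorm p (weightedMeasure K ε β l C) u ^ p :=
    le_mul_newtonianENorm_rpow hp hA'0 hA'top fun g' hg' =>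
      (hAh u g' f hu.1.aestronglyMeasurable hg' hfu).trans (mul_le_mul_left le_self_add _)
  have hnorm : eLpNorm f (ENNReal.ofReal p) ν ≤
      A' ^ (1 / p) * newtonianENorm p (weightedMeasure K ε β l C) u := by
    rw [eLpNorm_eq_lintegral_rpow_enorm_toReal (by simpa using hp0) (by simp),
      ENNReal.toReal_ofReal hp0.le]
    refine (ENNReal.rpow_le_rpow hbound (by positivity)).trans_eq ?_
    rw [ENNReal.mul_rpow_of_nonneg _ _ (by positivity), ← ENNReal.rpow_mul,
      mul_one_div_cancel hp0.ne', ENNReal.rpow_one]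
  have htop : A' ^ (1 / p) * newtonianENorm p (weightedMeasure K ε β l C) u < ∞ :=
    ENNReal.mul_lt_top (ENNReal.rpow_lt_top_of_nonneg (by positivity) hA'top) hu.2
  have hmem : MemLp f (ENNReal.ofReal p) ν := ⟨hfm.aestronglyMeasurable, hnorm.trans_lt htop⟩
  refine ⟨hmem.toLp f, ?_, ?_⟩
  · filter_upwards [hfu, hmem.coeFn_toLp] with ξ h1 h2
    rwa [h2]
  · rw [Lp.norm_toLp, newtonianNorm, ← ENNReal.toReal_mul]
    exact ENNReal.toReal_mono htop.ne hnorm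

/-- The bounded linear trace operator. -/
theorem exists_traceOperator (hK : 2 ≤ K) (hε : 0 < ε) {β p l C : ℝ} (hβ : Real.log K < β)
    (hp_eq : p = (β - Real.log K) / ε) (hp : 1 ≤ p) (hC : 0 < C)
    (h1 : 1 < p → p - 1 < l) (h2 : p = 1 → 0 ≤ l)
    {ν : Measure (TreeBoundary K)} (hν : TreeBoundary.AhlforsRegular ε (Real.log K / ε) ν) :
    ∃ T : newtonianSpace p hp (weightedMeasure K ε β l C) →ₗ[ℝ] Lp ℝ (ENNReal.ofReal p) ν,
      (∀ u : newtonianSpace p hp (weightedMeasure K ε β l C),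
        ∀ᵐ ξ ∂ν, Tendsto (fun t : ℝ => (u : RegularTree K ε → ℝ) (TreeBoundary.ray ε ξ t))
          atTop (𝓝 (T u ξ))) ∧
      ∃ A : ℝ, 0 ≤ A ∧ ∀ u : newtonianSpace p hp (weightedMeasure K ε β l C),
        ‖T u‖ ≤ A * newtonianNorm p (weightedMeasure K ε β l C) u := by
  obtain ⟨A, hA, h⟩ := exists_trace hK hε hβ hp_eq hp hC h1 h2 hν
  choose F hF hFA using h
  -- limits along rays are unique, so the chosen traces depend linearly on the function
  refine ⟨{ toFun := F, map_add' := fun u v => ?_, map_smul' := fun c u => ?_ }, hF, A, hA, hFA⟩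
  · apply Lp.ext
    filter_upwards [hF u, hF v, hF (u + v), Lp.coeFn_add (F u) (F v)] with ξ a b c d
    rw [d]
    exact tendsto_nhds_unique c (a.add b)
  · apply Lp.ext
    filter_upwards [hF u, hF (c • u), Lp.coeFn_smul c (F u)] with ξ a b d
    rw [RingHom.id_apply, d]
    exact tendsto_nhds_unique b (a.const_smul c)

/-! ### Sharpness of the weight -/

theorem isUpperGradient_log (hε : 0 < ε) :
    IsUpperGradient (K := K) (ε := ε)
      (fun x => ENNReal.ofReal (Real.exp (ε * x.height) / (x.height + 1)))
      fun x => Real.log (x.height + 1) := by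
  have hh := (continuous_height (K := K) hε).measurable
  refine isUpperGradient_of_anc (by fun_prop) fun x s hs hsx => ?_
  have e1 : ∫⁻ t in Set.Ioc s x.height,
      ENNReal.ofReal (Real.exp (ε * (x.anc t).height) / ((x.anc t).height + 1)) *
        ENNReal.ofReal (Real.exp (-ε * t)) =
      ∫⁻ t in Set.Ioc s x.height, ENNReal.ofReal ((t + 1)⁻¹) := by
    refine setLIntegral_congr_fun measurableSet_Ioc fun t ht => ?_
    rw [anc_height x (hs.trans ht.1.le) ht.2, ← ENNReal.ofReal_mul' (Real.exp_pos _).le,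
      div_mul_eq_mul_div, ← Real.exp_add]
    simp
  have hpos : ∀ t ∈ Set.uIcc s x.height, t + 1 ≠ 0 := fun t ht => by
    rw [Set.uIcc_of_le hsx] at ht
    have := hs.trans ht.1
    positivity
  have hint : IntervalIntegrable (fun t : ℝ => (t + 1)⁻¹) volume s x.height :=
    (ContinuousOn.inv₀ (by fun_prop) hpos).intervalIntegrable
  have hftc : ∫ t in s..x.height, (t + 1)⁻¹ =
      Real.log (x.height + 1) - Real.log (s + 1) := by
    refine intervalIntegral.integral_eq_sub_of_hasDerivAt (f := fun t => Real.log (t + 1))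
      (fun t ht => ?_) hint
    simpa using ((hasDerivAt_id t).add_const 1).log (hpos t ht)
  have hlog : Real.log (s + 1) ≤ Real.log (x.height + 1) :=
    Real.log_le_log (by linarith) (by linarith)
  rw [e1, anc_height x hs hsx, abs_of_nonneg (sub_nonneg.2 hlog), ← hftc,
    intervalIntegral.integral_of_le hsx, ofReal_integral_eq_lintegral_ofReal]
  · exact (intervalIntegrable_iff_integrableOn_Ioc_of_le hsx).1 hint
  · filter_upwards [ae_restrict_mem measurableSet_Ioc] with t ht
    have := hs.trans ht.1.le
    simp only [Pi.zero_apply]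
    positivity

/-- The bounds are `log (t + 1) ≤ t + C` for the function and `t + C ≤ max 1 C * (t + 1)` for the
gradient, whose energy density along a ray is then at most a multiple of `(t + C) ^ (-1 - δ)`. -/
theorem log_height_mem_newtonianSpace (hK : 2 ≤ K) (hε : 0 < ε) {β p δ C : ℝ}
    (hβ : Real.log K < β) (hp_eq : p = (β - Real.log K) / ε) (hp : 1 ≤ p) (hC : 0 < C)
    (hδ : 0 < δ)
    {ν : Measure (TreeBoundary K)} (hν : TreeBoundary.AhlforsRegular ε (Real.log K / ε) ν) :
    (fun x : RegularTree K ε => Real.log (x.height + 1)) ∈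
      newtonianSpace p hp (weightedMeasure K ε β (p - 1 - δ) C) := by
  have hp0 : 0 < p := by linarith
  have := hν.isFiniteMeasure hK hε
  have := isFiniteMeasure_weightedMeasure hK hε hβ hC (p - 1 - δ) hν
  obtain ⟨A, hA, hAh⟩ := lintegral_weightedMeasure_comparable hK hε β hν
  have hh := (continuous_height (K := K) hε).measurable
  have hconst : ∀ J : ℝ≥0∞, J < ∞ → A * ∫⁻ _ : TreeBoundary K, J ∂ν < ∞ := fun J hJ => by
    rw [lintegral_const]
    exact ENNReal.mul_lt_top hA.lt_top (ENNReal.mul_lt_top hJ (measure_lt_top _ _))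
  refine mem_newtonianSpace hp (by fun_prop) ?_ (isUpperGradient_log hε) ?_
  · refine ((hAh _ _ _ (by fun_prop)).2.trans (mul_le_mul_right (lintegral_mono fun ξ => ?_)
      _)).trans_lt (hconst _ (lintegral_radialWeight_lt_top (sub_pos.2 hβ) hC (p + (p - 1 - δ))))
    refine setLIntegral_mono' measurableSet_Ioi fun t ht => ?_
    have ht0 : 0 < t := ht
    have ht1 : 0 < t + C := add_pos ht hC
    have hl0 : 0 ≤ Real.log (t + 1) := Real.log_nonneg (by linarith)
    rw [TreeBoundary.ray_height ξ ht0.le, Real.enorm_of_nonneg hl0,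
      ENNReal.ofReal_rpow_of_nonneg hl0 hp0.le, radialWeight,
      ← ENNReal.ofReal_mul (by positivity), radialWeight, Real.rpow_add ht1]
    refine ENNReal.ofReal_le_ofReal ?_
    rw [mul_left_comm]
    refine mul_le_mul_of_nonneg_left (mul_le_mul_of_nonneg_right ?_ (by positivity)) (by positivity)
    refine Real.rpow_le_rpow hl0 ?_ hp0.le
    have := Real.log_le_sub_one_of_pos (show 0 < t + 1 by linarith)
    linarith
  · have hJ : ∫⁻ t in Set.Ioi (0 : ℝ), ENNReal.ofReal ((max 1 C) ^ p) *
        ENNReal.ofReal ((t + C) ^ (-1 - δ)) < ∞ := by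
      rw [lintegral_const_mul' _ _ ENNReal.ofReal_ne_top]
      exact ENNReal.mul_lt_top ENNReal.ofReal_lt_top
        (integrableOn_add_rpow_Ioi_of_lt (by linarith) (by linarith)).lintegral_lt_top
    refine ((hAh _ _ _ (by fun_prop)).2.trans (mul_le_mul_right (lintegral_mono fun ξ => ?_)
      _)).trans_lt (hconst _ hJ)
    refine setLIntegral_mono' measurableSet_Ioi fun t ht => ?_
    have ht0 : 0 < t := ht
    have ht1 : 0 < t + C := add_pos ht hC
    rw [TreeBoundary.ray_height ξ ht0.le, ENNReal.ofReal_rpow_of_nonneg (by positivity) hp0.le,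
      radialWeight, ← ENNReal.ofReal_mul (by positivity), ← ENNReal.ofReal_mul (by positivity)]
    refine ENNReal.ofReal_le_ofReal ?_
    have hexp : Real.exp (ε * t) ^ p * Real.exp (-(β - Real.log K) * t) = 1 := by
      rw [← Real.exp_mul, ← Real.exp_add, Real.exp_eq_one_iff, hp_eq]
      field_simp
      ring
    have hsplit : (t + C) ^ (p - 1 - δ) = (t + C) ^ p * (t + C) ^ (-1 - δ) := by
      rw [← Real.rpow_add ht1]; ring_nf
    have hquot : (t + C) ^ p ≤ max 1 C ^ p * (t + 1) ^ p := by
      rw [← Real.mul_rpow (by positivity) (by positivity)]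
      refine Real.rpow_le_rpow ht1.le ?_ hp0.le
      have h1 := mul_le_mul_of_nonneg_right (le_max_left 1 C) ht0.le
      have h2 := le_max_right 1 C
      linarith
    calc (Real.exp (ε * t) / (t + 1)) ^ p *
          (Real.exp (-(β - Real.log K) * t) * (t + C) ^ (p - 1 - δ))
        = (Real.exp (ε * t) ^ p * Real.exp (-(β - Real.log K) * t)) *
            ((t + C) ^ p / (t + 1) ^ p * (t + C) ^ (-1 - δ)) := by
          rw [Real.div_rpow (Real.exp_pos _).le (by positivity), hsplit]; ring
      _ ≤ max 1 C ^ p * (t + C) ^ (-1 - δ) := by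
          rw [hexp, one_mul]
          refine mul_le_mul_of_nonneg_right ?_ (by positivity)
          rwa [div_le_iff₀ (by positivity)]

end RegularTree

/-! ### Interpolation of vertex functions -/

namespace RegularTree

variable {K : ℕ} {ε : ℝ}

/-- The function on the tree that has the values `H` at the vertices and is affine in the height on
each edge. At the root, where `x.word.dropLast = x.word = []`, this is `H []`. -/
noncomputable def interpolate (H : List (Fin K) → ℝ) (x : RegularTree K ε) : ℝ :=
  H x.word.dropLast + (x.height - x.word.dropLast.length) * (H x.word - H x.word.dropLast)

/-- The slope of `interpolate H` with respect to the arc length `e^{-ε|z|} d|z|`. -/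
noncomputable def interpolateSlope (H : List (Fin K) → ℝ) (x : RegularTree K ε) : ℝ≥0∞ :=
  ‖H x.word - H x.word.dropLast‖ₑ * ENNReal.ofReal (Real.exp (ε * x.height))

theorem measurable_interpolate (hε : 0 < ε) (H : List (Fin K) → ℝ) :
    Measurable (interpolate H : RegularTree K ε → ℝ) :=
  measurable_of_word_height hε
    (φ := fun w t => H w.dropLast + (t - w.dropLast.length) * (H w - H w.dropLast))
    fun w => by fun_prop

theorem measurable_interpolateSlope (hε : 0 < ε) (H : List (Fin K) → ℝ) :
    Measurable (interpolateSlope H : RegularTree K ε → ℝ≥0∞) :=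
  measurable_of_word_height hε
    (φ := fun w t => ‖H w - H w.dropLast‖ₑ * ENNReal.ofReal (Real.exp (ε * t)))
    fun w => by fun_prop

theorem word_anc_of_mem_Ioc (x : RegularTree K ε) {n : ℕ} {t : ℝ}
    (ht : t ∈ Set.Ioc (n : ℝ) (n + 1)) (htx : t ≤ x.height) :
    (x.anc t).word = x.word.take (n + 1) ∧ (x.anc t).word.dropLast = x.word.take n ∧
      (x.word.take n).length = n := by
  have hc : ⌈t⌉₊ = n + 1 := by
    rw [Nat.ceil_eq_iff (by omega)]
    simpa using ht
  have hl : n + 1 ≤ x.word.length := by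
    rw [x.length_word, ← hc]; exact Nat.ceil_mono htx
  have hw : (x.anc t).word = x.word.take (n + 1) := by
    rw [anc_word x ((Nat.cast_nonneg n).trans ht.1.le) htx, hc]
  refine ⟨hw, ?_, by rw [List.length_take]; omega⟩
  rw [hw, List.dropLast_eq_take, List.take_take, List.length_take]
  congr 1
  omega

theorem interpolate_anc (H : List (Fin K) → ℝ) (x : RegularTree K ε) {n : ℕ} {t : ℝ}
    (hnt : n ≤ t) (htn : t ≤ n + 1) (htx : t ≤ x.height) :
    interpolate H (x.anc t) = H (x.word.take n) +
      (t - n) * (H (x.word.take (n + 1)) - H (x.word.take n)) := by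
  rcases hnt.eq_or_lt with rfl | hlt
  · rcases n with _ | m
    · have hw : (x.anc (0 : ℕ)).word = [] := by
        rw [anc_word x (by simp) htx]; simp
      have hh : (x.anc (0 : ℕ)).height = 0 := by
        rw [anc_height x (by simp) htx]; simp
      rw [interpolate, hw, hh]
      simp
    · obtain ⟨h1, h2, h3⟩ := x.word_anc_of_mem_Ioc (n := m) (t := (m + 1 : ℕ))
        ⟨by simp, by simp⟩ htx
      rw [interpolate, h2, h1, h3, anc_height x (by positivity) htx]
      push_cast
      ring
  · obtain ⟨h1, h2, h3⟩ := x.word_anc_of_mem_Ioc ⟨hlt, htn⟩ htx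
    rw [interpolate, h2, h1, h3, anc_height x ((Nat.cast_nonneg n).trans hnt) htx]

theorem interpolateSlope_anc (H : List (Fin K) → ℝ) (x : RegularTree K ε) {n : ℕ} {t : ℝ}
    (ht : t ∈ Set.Ioc (n : ℝ) (n + 1)) (htx : t ≤ x.height) :
    interpolateSlope H (x.anc t) * ENNReal.ofReal (Real.exp (-ε * t)) =
      ‖H (x.word.take (n + 1)) - H (x.word.take n)‖ₑ := by
  obtain ⟨h1, h2, -⟩ := x.word_anc_of_mem_Ioc ht htx
  rw [interpolateSlope, h2, h1, anc_height x ((Nat.cast_nonneg n).trans ht.1.le) htx, mul_assoc,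
    ← ENNReal.ofReal_mul (Real.exp_pos _).le, ← Real.exp_add]
  simp

/-- On a single edge this is an equality; general segments are cut at the vertices. -/
theorem isUpperGradient_interpolateSlope (hε : 0 < ε) (H : List (Fin K) → ℝ) :
    IsUpperGradient (K := K) (ε := ε) (interpolateSlope H) (interpolate H) := by
  refine isUpperGradient_of_anc (measurable_interpolateSlope hε H) fun x s hs hsx => ?_
  set φ : ℝ → ℝ≥0∞ := fun t =>
    interpolateSlope H (x.anc t) * ENNReal.ofReal (Real.exp (-ε * t)) with hφ
  have key : ∀ (n : ℕ) (s b : ℝ), 0 ≤ s → s ≤ b → b ≤ x.height → b ≤ n →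
      ‖interpolate H (x.anc b) - interpolate H (x.anc s)‖ₑ ≤ ∫⁻ t in Set.Ioc s b, φ t := by
    intro n
    induction n with
    | zero =>
      intro s b hs hsb hbx hb
      have : b = s := le_antisymm (by simpa using hb.trans (by simpa using hs)) hsb
      simp [this]
    | succ n ih =>
      have edge : ∀ s b : ℝ, n ≤ s → s ≤ b → b ≤ x.height → b ≤ n + 1 →
          ‖interpolate H (x.anc b) - interpolate H (x.anc s)‖ₑ ≤ ∫⁻ t in Set.Ioc s b, φ t := by
        intro s b hns hsb hbx hb
        have e : ∫⁻ t in Set.Ioc s b, φ t = ∫⁻ _ in Set.Ioc s b,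
            ‖H (x.word.take (n + 1)) - H (x.word.take n)‖ₑ :=
          setLIntegral_congr_fun measurableSet_Ioc fun t ht =>
            interpolateSlope_anc H x ⟨hns.trans_lt ht.1, ht.2.trans hb⟩ (ht.2.trans hbx)
        rw [e, setLIntegral_const, Real.volume_Ioc, interpolate_anc H x (hns.trans hsb) hb hbx,
          interpolate_anc H x hns (hsb.trans hb) (hsb.trans hbx), add_sub_add_left_eq_sub,
          ← sub_mul, sub_sub_sub_cancel_right, enorm_mul,
          Real.enorm_of_nonneg (sub_nonneg.2 hsb), mul_comm]
      intro s b hs hsb hbx hb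
      push_cast at hb
      rcases le_total b n with hbn | hbn
      · exact ih s b hs hsb hbx hbn
      rcases le_total (n : ℝ) s with hns | hns
      · exact edge s b hns hsb hbx hb
      rw [← Set.Ioc_union_Ioc_eq_Ioc hns hbn,
        lintegral_union measurableSet_Ioc (Set.Ioc_disjoint_Ioc_of_le le_rfl), add_comm]
      refine le_trans ?_ (add_le_add (edge n b le_rfl hbn hbx hb)
        (ih s n hs hns (hbn.trans hbx) le_rfl))
      rw [← sub_add_sub_cancel _ (interpolate H (x.anc n))]
      exact enorm_add_le _ _
  have h := key ⌈x.height⌉₊ s x.height hs hsx le_rfl (Nat.le_ceil _)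
  rwa [anc_self, Real.enorm_eq_ofReal_abs] at h

theorem interpolate_ray (H : List (Fin K) → ℝ) (ξ : TreeBoundary K) {n : ℕ} {t : ℝ}
    (hnt : n ≤ t) (htn : t ≤ n + 1) :
    interpolate H (TreeBoundary.ray ε ξ t) = H (TreeBoundary.prefixWord ξ n) +
      (t - n) * (H (TreeBoundary.prefixWord ξ (n + 1)) - H (TreeBoundary.prefixWord ξ n)) := by
  have h0 : (0 : ℝ) ≤ n + 1 := by positivity
  have hw : (TreeBoundary.ray ε ξ (n + 1)).word = TreeBoundary.prefixWord ξ (n + 1) := by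
    rw [TreeBoundary.ray_word ξ h0]
    congr 1
    exact_mod_cast Nat.ceil_natCast (R := ℝ) (n + 1)
  rw [← TreeBoundary.anc_ray ξ ((Nat.cast_nonneg n).trans hnt) htn,
    interpolate_anc H _ hnt htn (by rwa [TreeBoundary.ray_height ξ h0]), hw,
    TreeBoundary.take_prefixWord ξ n.le_succ, TreeBoundary.take_prefixWord ξ (le_refl (n + 1))]

theorem interpolateSlope_ray (H : List (Fin K) → ℝ) (ξ : TreeBoundary K) {n : ℕ} {t : ℝ}
    (ht : t ∈ Set.Ioc (n : ℝ) (n + 1)) :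
    interpolateSlope H (TreeBoundary.ray ε ξ t) * ENNReal.ofReal (Real.exp (-ε * t)) =
      ‖H (TreeBoundary.prefixWord ξ (n + 1)) - H (TreeBoundary.prefixWord ξ n)‖ₑ := by
  have h0 : (0 : ℝ) ≤ n + 1 := by positivity
  have hw : (TreeBoundary.ray ε ξ (n + 1)).word = TreeBoundary.prefixWord ξ (n + 1) := by
    rw [TreeBoundary.ray_word ξ h0]
    congr 1
    exact_mod_cast Nat.ceil_natCast (R := ℝ) (n + 1)
  rw [← TreeBoundary.anc_ray ξ ((Nat.cast_nonneg n).trans ht.1.le) ht.2,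
    interpolateSlope_anc H _ ht (by rw [TreeBoundary.ray_height ξ h0]; exact ht.2), hw,
    TreeBoundary.take_prefixWord ξ n.le_succ, TreeBoundary.take_prefixWord ξ (le_refl (n + 1))]

/-- Affine interpolation stays at least as close to `L` as the worse of the two end values. -/
theorem enorm_interpolate_ray_sub_le (H : List (Fin K) → ℝ) (ξ : TreeBoundary K) (L : ℝ) {n : ℕ}
    {t : ℝ} (hnt : n ≤ t) (htn : t ≤ n + 1) :
    ‖interpolate H (TreeBoundary.ray ε ξ t) - L‖ₑ ≤
      max ‖H (TreeBoundary.prefixWord ξ n) - L‖ₑ ‖H (TreeBoundary.prefixWord ξ (n + 1)) - L‖ₑ := by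
  rw [interpolate_ray H ξ hnt htn]
  set a := H (TreeBoundary.prefixWord ξ n)
  set b := H (TreeBoundary.prefixWord ξ (n + 1))
  simp only [Real.enorm_eq_ofReal_abs, ← ENNReal.ofReal_max]
  refine ENNReal.ofReal_le_ofReal ?_
  have e : a + (t - n) * (b - a) - L = (1 - (t - n)) * (a - L) + (t - n) * (b - L) := by ring
  rw [e]
  refine (abs_add_le _ _).trans ?_
  rw [abs_mul, abs_mul, abs_of_nonneg (by linarith : 0 ≤ 1 - (t - n)),
    abs_of_nonneg (by linarith : 0 ≤ t - n)]
  have h1 := mul_le_mul_of_nonneg_left (le_max_left |a - L| |b - L|)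
    (by linarith : 0 ≤ 1 - (t - n))
  have h2 := mul_le_mul_of_nonneg_left (le_max_right |a - L| |b - L|)
    (by linarith : 0 ≤ t - n)
  linarith

theorem tendsto_interpolate_ray {H : List (Fin K) → ℝ} {ξ : TreeBoundary K} {L : ℝ}
    (h : Tendsto (fun n => H (TreeBoundary.prefixWord ξ n)) atTop (𝓝 L)) :
    Tendsto (fun t : ℝ => interpolate H (TreeBoundary.ray ε ξ t)) atTop (𝓝 L) := by
  rw [tendsto_iff_edist_tendsto_0] at h ⊢
  simp only [edist_eq_enorm_sub] at h ⊢
  have h2 := (h.max (h.comp (tendsto_add_atTop_nat 1))).comp (tendsto_nat_floor_atTop (α := ℝ))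
  rw [max_self] at h2
  refine tendsto_of_tendsto_of_tendsto_of_le_of_le' tendsto_const_nhds h2
    (Eventually.of_forall fun _ => zero_le) ?_
  filter_upwards [eventually_ge_atTop 0] with t ht
  exact enorm_interpolate_ray_sub_le H ξ L (Nat.floor_le ht) (Nat.lt_floor_add_one t).le

theorem lintegral_interpolateSlope_ray {β p : ℝ} (hε : 0 < ε)
    (hp_eq : p = (β - Real.log K) / ε) (hp : 1 ≤ p) (C : ℝ)
    (H : List (Fin K) → ℝ) (ξ : TreeBoundary K) :
    ∫⁻ t in Set.Ioi 0, interpolateSlope H (TreeBoundary.ray ε ξ t) ^ p *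
        radialWeight (β - Real.log K) 0 C t =
      ∑' n, ‖H (TreeBoundary.prefixWord ξ (n + 1)) - H (TreeBoundary.prefixWord ξ n)‖ₑ ^ p := by
  have hp0 : 0 ≤ p := by linarith
  rw [lintegral_Ioi_eq_tsum]
  congr 1 with n
  have e : ∀ t ∈ Set.Ioc (n : ℝ) (n + 1), interpolateSlope H (TreeBoundary.ray ε ξ t) ^ p *
      radialWeight (β - Real.log K) 0 C t =
      ‖H (TreeBoundary.prefixWord ξ (n + 1)) - H (TreeBoundary.prefixWord ξ n)‖ₑ ^ p := by
    intro t ht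
    have e1 : -(β - Real.log K) * t = -ε * t * p := by rw [hp_eq]; field_simp
    rw [← interpolateSlope_ray (ε := ε) H ξ ht, ENNReal.mul_rpow_of_nonneg _ _ hp0,
      ENNReal.ofReal_rpow_of_pos (Real.exp_pos _), ← Real.exp_mul, radialWeight, Real.rpow_zero,
      mul_one, e1]
  rw [setLIntegral_congr_fun measurableSet_Ioc e, setLIntegral_const, Real.volume_Ioc]
  simp

theorem lintegral_interpolate_ray_le {p : ℝ} (hp : 1 ≤ p) (a C : ℝ)
    (H : List (Fin K) → ℝ) (ξ : TreeBoundary K) :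
    ∫⁻ t in Set.Ioi 0, ‖interpolate H (TreeBoundary.ray ε ξ t)‖ₑ ^ p * radialWeight a 0 C t ≤
      ∑' n : ℕ, (‖H (TreeBoundary.prefixWord ξ n)‖ₑ ^ p +
        ‖H (TreeBoundary.prefixWord ξ (n + 1))‖ₑ ^ p) *
          ∫⁻ t in Set.Ioc (n : ℝ) (n + 1), radialWeight a 0 C t := by
  have hp0 : 0 ≤ p := by linarith
  rw [lintegral_Ioi_eq_tsum]
  refine ENNReal.tsum_le_tsum fun n => ?_
  rw [← lintegral_const_mul _ (measurable_radialWeight a 0 C)]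
  refine setLIntegral_mono' measurableSet_Ioc fun t ht => mul_le_mul_left ?_ _
  have h := enorm_interpolate_ray_sub_le (ε := ε) H ξ 0 ht.1.le ht.2
  simp only [sub_zero] at h
  refine (ENNReal.rpow_le_rpow h hp0).trans ?_
  rcases max_choice ‖H (TreeBoundary.prefixWord ξ n)‖ₑ
    ‖H (TreeBoundary.prefixWord ξ (n + 1))‖ₑ with h | h <;> rw [h]
  · exact le_self_add
  · exact le_add_self

/-- The norm of an interpolated vertex function is controlled by the `L^p` norms of its values and
by the sum of the `L^p` norms of its increments from one generation to the next. -/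
theorem exists_interpolate_bound (hK : 2 ≤ K) (hε : 0 < ε) {β p C : ℝ} (hβ : Real.log K < β)
    (hp_eq : p = (β - Real.log K) / ε) (hp : 1 ≤ p) (hC : 0 < C)
    {ν : Measure (TreeBoundary K)} (hν : TreeBoundary.AhlforsRegular ε (Real.log K / ε) ν) :
    ∃ A : ℝ≥0∞, A ≠ ∞ ∧ ∀ (H : List (Fin K) → ℝ) (M : ℝ≥0∞),
      (∀ n, ∫⁻ ξ, ‖H (TreeBoundary.prefixWord ξ n)‖ₑ ^ p ∂ν ≤ M) →
      (∑' n, ∫⁻ ξ, ‖H (TreeBoundary.prefixWord ξ (n + 1)) -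
        H (TreeBoundary.prefixWord ξ n)‖ₑ ^ p ∂ν ≤ M) →
      ∫⁻ x, ‖interpolate H x‖ₑ ^ p ∂weightedMeasure K ε β 0 C ≤ A * M ∧
      ∫⁻ x, interpolateSlope H x ^ p ∂weightedMeasure K ε β 0 C ≤ A * M := by
  obtain ⟨A, hA, hAh⟩ := lintegral_weightedMeasure_comparable hK hε β hν
  set W := ∫⁻ t in Set.Ioi 0, radialWeight (β - Real.log K) 0 C t with hW
  have hWtop : W ≠ ∞ := (lintegral_radialWeight_lt_top (sub_pos.2 hβ) hC 0).ne
  have hm : ∀ (H : List (Fin K) → ℝ) (n : ℕ), Measurable fun ξ : TreeBoundary K =>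
      ‖H (TreeBoundary.prefixWord ξ n)‖ₑ ^ p := fun H n =>
    TreeBoundary.measurable_comp_prefixWord (fun w => ‖H w‖ₑ ^ p) n
  have hm2 : ∀ (H : List (Fin K) → ℝ) (n : ℕ), Measurable fun ξ : TreeBoundary K =>
      ‖H (TreeBoundary.prefixWord ξ n)‖ₑ ^ p + ‖H (TreeBoundary.prefixWord ξ (n + 1))‖ₑ ^ p :=
    fun H n => (hm H n).add (hm H (n + 1))
  refine ⟨A * (2 * W + 1), ENNReal.mul_ne_top hA (by finiteness), fun H M hM hD => ⟨?_, ?_⟩⟩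
  · refine (hAh 0 C _ ((measurable_interpolate hε H).enorm.pow_const p)).2.trans ?_
    rw [mul_assoc]
    refine mul_le_mul_right ?_ _
    refine (lintegral_mono fun ξ => lintegral_interpolate_ray_le hp _ C H ξ).trans ?_
    rw [lintegral_tsum fun n => ((hm2 H n).mul_const _).aemeasurable]
    have hn : ∀ n : ℕ, ∫⁻ ξ, (‖H (TreeBoundary.prefixWord ξ n)‖ₑ ^ p +
        ‖H (TreeBoundary.prefixWord ξ (n + 1))‖ₑ ^ p) *
          (∫⁻ t in Set.Ioc (n : ℝ) (n + 1), radialWeight (β - Real.log K) 0 C t) ∂ν ≤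
        2 * M * ∫⁻ t in Set.Ioc (n : ℝ) (n + 1), radialWeight (β - Real.log K) 0 C t := by
      intro n
      rw [lintegral_mul_const _ (hm2 H n), lintegral_add_left (hm H n), two_mul]
      exact mul_le_mul_left (add_le_add (hM n) (hM (n + 1))) _
    refine (ENNReal.tsum_le_tsum hn).trans ?_
    rw [ENNReal.tsum_mul_left, ← lintegral_Ioi_eq_tsum, ← hW, mul_right_comm]
    exact mul_le_mul_left le_self_add _
  · refine (hAh 0 C _ ((measurable_interpolateSlope hε H).pow_const p)).2.trans ?_
    rw [mul_assoc]
    refine mul_le_mul_right ?_ _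
    rw [lintegral_congr fun ξ => lintegral_interpolateSlope_ray hε hp_eq hp C H ξ, lintegral_tsum]
    · refine hD.trans ?_
      rw [add_mul, one_mul]
      exact le_add_self
    · intro n
      have h1 := TreeBoundary.measurable_comp_prefixWord H (n + 1)
      have h2 := TreeBoundary.measurable_comp_prefixWord H n
      exact ((h1.sub h2).enorm.pow_const p).aemeasurable

end RegularTree

/-! ### Approximation by functions of finitely many letters -/

/-- A slowly growing index: given thresholds `n 0, n 1, …`, it starts at `0` and moves up by one
at time `N + 1` if the threshold of the next index is at most `N + 1`. -/
def slowIndex (n : ℕ → ℕ) : ℕ → ℕ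
  | 0 => 0
  | N + 1 => if n (slowIndex n N + 1) ≤ N + 1 then slowIndex n N + 1 else slowIndex n N

theorem threshold_slowIndex_le {n : ℕ → ℕ} (h0 : n 0 = 0) (N : ℕ) : n (slowIndex n N) ≤ N := by
  induction N with
  | zero => simp [slowIndex, h0]
  | succ N ih =>
    rw [slowIndex]
    split_ifs with h
    · exact h
    · omega

theorem slowIndex_le_succ (n : ℕ → ℕ) (N : ℕ) : slowIndex n N ≤ slowIndex n (N + 1) := by
  rw [slowIndex]
  split_ifs <;> omega

theorem tendsto_slowIndex (n : ℕ → ℕ) : Tendsto (slowIndex n) atTop atTop := by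
  have hmono : Monotone (slowIndex n) := monotone_nat_of_le_succ (slowIndex_le_succ n)
  refine tendsto_atTop_atTop_of_monotone hmono fun k => ?_
  induction k with
  | zero => exact ⟨0, Nat.zero_le _⟩
  | succ k ih =>
    obtain ⟨N, hN⟩ := ih
    set M := max N (n (k + 1))
    have hM : k ≤ slowIndex n M := hN.trans (hmono (le_max_left _ _))
    rcases hM.eq_or_lt with h | h
    · refine ⟨M + 1, ?_⟩
      have : n (k + 1) ≤ M + 1 := (le_max_right _ _).trans (Nat.le_succ _)
      rw [slowIndex, ← h, if_pos this]
    · exact ⟨M, h⟩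

/-- The increments along `slowIndex` are increments by one step, each of which occurs at most
once. -/
theorem tsum_slowIndex_le (n : ℕ → ℕ) (d : ℕ → ℕ → ℝ≥0∞) (hd : ∀ k, d k k = 0) :
    ∑' N, d (slowIndex n N) (slowIndex n (N + 1)) ≤ ∑' k, d k (k + 1) := by
  refine ENNReal.tsum_le_of_sum_range_le fun M => ?_
  have h : ∑ N ∈ Finset.range M, d (slowIndex n N) (slowIndex n (N + 1)) =
      ∑ k ∈ Finset.range (slowIndex n M), d k (k + 1) := by
    induction M with
    | zero => simp [slowIndex]
    | succ M ih =>
      rw [Finset.sum_range_succ, ih, slowIndex]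
      split_ifs
      · rw [Finset.sum_range_succ]
      · rw [hd, add_zero]
  rw [h]
  exact ENNReal.sum_le_tsum _

theorem lintegral_enorm_add_rpow_le {α : Type*} [MeasurableSpace α] {μ : Measure α} {p : ℝ}
    (hp : 1 ≤ p) {f g : α → ℝ} (hf : Measurable f) :
    ∫⁻ x, ‖f x + g x‖ₑ ^ p ∂μ ≤
      2 ^ (p - 1) * ((∫⁻ x, ‖f x‖ₑ ^ p ∂μ) + ∫⁻ x, ‖g x‖ₑ ^ p ∂μ) := by
  rw [← lintegral_add_left (hf.enorm.pow_const p), ← lintegral_const_mul' _ _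
    (ENNReal.rpow_ne_top_of_nonneg (by linarith) (by simp))]
  exact lintegral_mono fun x => (ENNReal.rpow_le_rpow (enorm_add_le _ _) (by linarith)).trans
    (ENNReal.rpow_add_le_mul_rpow_add_rpow _ _ hp)

namespace TreeBoundary

variable {K : ℕ}

/-- Functions of finitely many letters are dense in `L^p`: bounded continuous functions are dense,
and such a function is the limit of its values at truncated words. -/
theorem exists_prefixWord_approx (hK : 0 < K) {ν : Measure (TreeBoundary K)} [IsFiniteMeasure ν]
    {p : ℝ} (hp : 1 ≤ p) {f : TreeBoundary K → ℝ} (hf : MemLp f (ENNReal.ofReal p) ν)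
    {η : ℝ≥0∞} (hη : η ≠ 0) :
    ∃ (N : ℕ) (G : List (Fin K) → ℝ), ∫⁻ ξ, ‖G (prefixWord ξ N) - f ξ‖ₑ ^ p ∂ν ≤ η := by
  have hp0 : 0 < p := by linarith
  have h2p0 : (2 : ℝ≥0∞) ^ p ≠ 0 := by simp
  have h2p : (2 : ℝ≥0∞) ^ p ≠ ∞ := ENNReal.rpow_ne_top_of_nonneg hp0.le (by simp)
  set η' := η / 2 ^ p with hη'
  have hη'0 : η' ≠ 0 := (ENNReal.div_pos hη h2p).ne'
  obtain ⟨g, hg, -⟩ := hf.exists_boundedContinuous_eLpNorm_sub_le (by simp)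
    (ε := η' ^ (1 / p)) (by simp [hη'0, hp0.le])
  have hg' : ∫⁻ ξ, ‖g ξ - f ξ‖ₑ ^ p ∂ν ≤ η' := by
    rw [eLpNorm_eq_lintegral_rpow_enorm_toReal (by simpa using hp0) (by simp),
      ENNReal.toReal_ofReal hp0.le, ENNReal.rpow_le_rpow_iff (by positivity)] at hg
    refine le_trans (le_of_eq (lintegral_congr fun ξ => ?_)) hg
    rw [Pi.sub_apply, ← enorm_neg, neg_sub]
  set G : List (Fin K) → ℝ := fun w => g fun i => w.getD i ⟨0, hK⟩ with hG
  have hlim : Tendsto (fun N => ∫⁻ ξ, ‖G (prefixWord ξ N) - g ξ‖ₑ ^ p ∂ν) atTop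
      (𝓝 (∫⁻ _, 0 ∂ν)) := by
    refine tendsto_lintegral_of_dominated_convergence (fun _ => ENNReal.ofReal (2 * ‖g‖) ^ p)
      (fun N => ?_) (fun N => Eventually.of_forall fun ξ => ?_) ?_
      (Eventually.of_forall fun ξ => ?_)
    · exact ((measurable_comp_prefixWord G N).sub g.continuous.measurable).enorm.pow_const p
    · refine ENNReal.rpow_le_rpow ?_ hp0.le
      rw [← ofReal_norm, ← dist_eq_norm]
      exact ENNReal.ofReal_le_ofReal (g.dist_le_two_norm _ _)
    · rw [lintegral_const]
      exact ENNReal.mul_ne_top (ENNReal.rpow_ne_top_of_nonneg hp0.le ENNReal.ofReal_ne_top)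
        (measure_ne_top _ _)
    · have h1 : Tendsto (fun N => fun i => (prefixWord ξ N).getD i ⟨0, hK⟩) atTop (𝓝 ξ) := by
        refine tendsto_pi_nhds.2 fun i => tendsto_const_nhds.congr' ?_
        filter_upwards [eventually_gt_atTop i] with N hN
        rw [List.getD_eq_getElem _ _ (by simpa using hN)]
        simp [prefixWord]
      have h2 := (g.continuous.tendsto ξ).comp h1
      have h3 := ((h2.sub_const (g ξ)).enorm).ennrpow_const p
      rw [sub_self, enorm_zero, ENNReal.zero_rpow_of_pos hp0] at h3
      exact h3
  rw [lintegral_zero] at hlim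
  obtain ⟨N, hN⟩ := (hlim.eventually_lt_const (pos_iff_ne_zero.2 hη'0)).exists
  refine ⟨N, G, ?_⟩
  have h := lintegral_enorm_add_rpow_le (μ := ν) hp (f := fun ξ => G (prefixWord ξ N) - g ξ)
    (g := fun ξ => g ξ - f ξ) ((measurable_comp_prefixWord G N).sub g.continuous.measurable)
  simp only [sub_add_sub_cancel] at h
  refine h.trans ((mul_le_mul_right (add_le_add hN.le hg') _).trans_eq ?_)
  rw [← two_mul, ← mul_assoc]
  have : (2 : ℝ≥0∞) ^ (p - 1) * 2 = 2 ^ p := by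
    nth_rewrite 2 [← ENNReal.rpow_one 2]
    rw [← ENNReal.rpow_add _ _ (by simp) (by simp), sub_add_cancel]
  rw [this, hη', ENNReal.mul_div_cancel h2p0 h2p]

/-- Every `f` in `L^p` is the boundary limit of a vertex function whose increments from one
generation to the next are summable in `L^p` with the right bound. Approximations of `f` with
errors `2^{-k}` are used one after the other, each as soon as the generation is large enough for
it. The dependence on `f` is not linear. -/
theorem exists_vertexFunction (hK : 0 < K) {ν : Measure (TreeBoundary K)} [IsFiniteMeasure ν]
    {p : ℝ} (hp : 1 ≤ p) {f : TreeBoundary K → ℝ} (hfm : Measurable f)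
    (hf : MemLp f (ENNReal.ofReal p) ν) :
    ∃ H : List (Fin K) → ℝ,
      (∀ n, ∫⁻ ξ, ‖H (prefixWord ξ n)‖ₑ ^ p ∂ν ≤ 2 ^ p * 2 * ∫⁻ ξ, ‖f ξ‖ₑ ^ p ∂ν) ∧
      (∑' n, ∫⁻ ξ, ‖H (prefixWord ξ (n + 1)) - H (prefixWord ξ n)‖ₑ ^ p ∂ν ≤
        2 ^ p * 2 * ∫⁻ ξ, ‖f ξ‖ₑ ^ p ∂ν) ∧
      ∀ᵐ ξ ∂ν, Tendsto (fun n => H (prefixWord ξ n)) atTop (𝓝 (f ξ)) := by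
  have hp0 : 0 < p := by linarith
  set S := ∫⁻ ξ, ‖f ξ‖ₑ ^ p ∂ν with hS
  have hStop : S ≠ ∞ := by
    have := hf.2
    rw [eLpNorm_lt_top_iff_lintegral_rpow_enorm_lt_top (by simpa using hp0) (by simp),
      ENNReal.toReal_ofReal hp0.le] at this
    exact this.ne
  have hex : ∀ k : ℕ, ∃ (N : ℕ) (G : List (Fin K) → ℝ), (k = 0 → N = 0) ∧
      ∫⁻ ξ, ‖G (prefixWord ξ N) - f ξ‖ₑ ^ p ∂ν ≤ 2⁻¹ ^ k * S := by
    intro k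
    by_cases hk : k = 0
    · -- the zero function, which makes `‖F_0 - f‖ = ‖f‖` and needs no letter
      refine ⟨0, 0, fun _ => rfl, ?_⟩
      simp [hk, hS]
    · by_cases hS0 : S = 0
      · -- no positive error is allowed here, but `f = 0` almost everywhere
        refine ⟨0, 0, fun _ => rfl, ?_⟩
        simp only [Pi.zero_apply, zero_sub, enorm_neg]
        rw [← hS, hS0]
        exact zero_le
      · obtain ⟨N, G, h⟩ := exists_prefixWord_approx hK hp hf (η := 2⁻¹ ^ k * S)
          (mul_ne_zero (pow_ne_zero _ (by simp)) hS0)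
        exact ⟨N, G, fun h => absurd h hk, h⟩
  choose n G hn0 hG using hex
  set F : ℕ → TreeBoundary K → ℝ := fun k ξ => G k (prefixWord ξ (n k)) with hF
  have hFm : ∀ k, Measurable (F k) := fun k => measurable_comp_prefixWord (G k) (n k)
  have h2p : (2 : ℝ≥0∞) ^ (p - 1) * 2 = 2 ^ p := by
    nth_rewrite 2 [← ENNReal.rpow_one 2]
    rw [← ENNReal.rpow_add _ _ (by simp) (by simp), sub_add_cancel]
  have hpow : ∀ k : ℕ, (2⁻¹ : ℝ≥0∞) ^ k ≤ 1 := fun k => pow_le_one' (by simp) k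
  have hFbound : ∀ k, ∫⁻ ξ, ‖F k ξ‖ₑ ^ p ∂ν ≤ 2 ^ p * 2 * S := by
    intro k
    have h := lintegral_enorm_add_rpow_le (μ := ν) hp (f := fun ξ => F k ξ - f ξ) (g := f)
      ((hFm k).sub hfm)
    simp only [sub_add_cancel] at h
    have h1 : ∫⁻ ξ, ‖F k ξ - f ξ‖ₑ ^ p ∂ν ≤ S :=
      (hG k).trans (mul_le_of_le_one_left zero_le (hpow k))
    refine h.trans ((mul_le_mul_right (add_le_add h1 le_rfl) _).trans ?_)
    rw [← two_mul, ← mul_assoc, h2p]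
    exact mul_le_mul_left (le_mul_of_one_le_right zero_le (by norm_num)) _
  have hFdiff : ∀ k, ∫⁻ ξ, ‖F (k + 1) ξ - F k ξ‖ₑ ^ p ∂ν ≤ 2 ^ p * S * 2⁻¹ ^ k := by
    intro k
    have h := lintegral_enorm_add_rpow_le (μ := ν) hp (f := fun ξ => F (k + 1) ξ - f ξ)
      (g := fun ξ => f ξ - F k ξ) ((hFm _).sub hfm)
    simp only [sub_add_sub_cancel] at h
    have h1 : ∫⁻ ξ, ‖F (k + 1) ξ - f ξ‖ₑ ^ p ∂ν ≤ 2⁻¹ ^ k * S := by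
      refine (hG (k + 1)).trans (mul_le_mul_left ?_ _)
      rw [pow_succ]
      exact mul_le_of_le_one_right zero_le (by simp)
    have h2 : ∫⁻ ξ, ‖f ξ - F k ξ‖ₑ ^ p ∂ν ≤ 2⁻¹ ^ k * S := by
      refine le_trans (le_of_eq (lintegral_congr fun ξ => ?_)) (hG k)
      rw [← enorm_neg, neg_sub]
    refine h.trans ((mul_le_mul_right (add_le_add h1 h2) _).trans_eq ?_)
    rw [← two_mul, ← mul_assoc, h2p, mul_assoc, mul_comm S]
  have hgeom : ∑' k : ℕ, (2⁻¹ : ℝ≥0∞) ^ k = 2 := by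
    rw [ENNReal.tsum_geometric, ENNReal.one_sub_inv_two, inv_inv]
  have hFlim : ∀ᵐ ξ ∂ν, Tendsto (fun k => F k ξ) atTop (𝓝 (f ξ)) := by
    have hm : ∀ k, Measurable fun ξ => ‖F k ξ - f ξ‖ₑ ^ p := fun k =>
      ((hFm k).sub hfm).enorm.pow_const p
    have hsum : ∫⁻ ξ, ∑' k, ‖F k ξ - f ξ‖ₑ ^ p ∂ν ≠ ∞ := by
      rw [lintegral_tsum fun k => (hm k).aemeasurable]
      refine ((ENNReal.tsum_le_tsum hG).trans_lt ?_).ne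
      rw [ENNReal.tsum_mul_right, hgeom]
      exact ENNReal.mul_lt_top (by simp) hStop.lt_top
    filter_upwards [ae_lt_top (Measurable.tsum hm) hsum] with ξ hξ
    have h1 := (ENNReal.tendsto_atTop_zero_of_tsum_ne_top hξ.ne).ennrpow_const (1 / p)
    simp only [← ENNReal.rpow_mul, mul_one_div_cancel hp0.ne', ENNReal.rpow_one,
      ENNReal.zero_rpow_of_pos (one_div_pos.2 hp0)] at h1
    rw [tendsto_iff_edist_tendsto_0]
    simpa only [edist_eq_enorm_sub] using h1
  set σ := slowIndex n
  have hH : ∀ (N : ℕ) (ξ : TreeBoundary K),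
      G (σ (prefixWord ξ N).length) ((prefixWord ξ N).take (n (σ (prefixWord ξ N).length))) =
        F (σ N) ξ := fun N ξ => by
    rw [length_prefixWord, take_prefixWord ξ (threshold_slowIndex_le (hn0 0 rfl) N)]
  refine ⟨fun w => G (σ w.length) (w.take (n (σ w.length))), ?_, ?_, ?_⟩
  · intro N
    simp only [hH]
    exact hFbound _
  · simp only [hH]
    refine (tsum_slowIndex_le n (fun j k => ∫⁻ ξ, ‖F k ξ - F j ξ‖ₑ ^ p ∂ν) ?_).trans ?_
    · intro k
      simp [hp0]
    · refine (ENNReal.tsum_le_tsum hFdiff).trans_eq ?_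
      rw [ENNReal.tsum_mul_left, hgeom, mul_right_comm]
  · filter_upwards [hFlim] with ξ hξ
    simp only [hH]
    exact hξ.comp (tendsto_slowIndex n)

end TreeBoundary

/-! ### The extension operator -/

namespace RegularTree

variable {K : ℕ} {ε : ℝ}

/-- The bounded nonlinear extension operator. -/
theorem exists_extensionOperator (hK : 2 ≤ K) (hε : 0 < ε) {β p C : ℝ} (hβ : Real.log K < β)
    (hp_eq : p = (β - Real.log K) / ε) (hp : 1 ≤ p) (hC : 0 < C)
    {ν : Measure (TreeBoundary K)} (hν : TreeBoundary.AhlforsRegular ε (Real.log K / ε) ν) :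
    ∃ E : Lp ℝ (ENNReal.ofReal p) ν → newtonianSpace p hp (weightedMeasure K ε β 0 C),
      (∃ A : ℝ, 0 ≤ A ∧ ∀ f : Lp ℝ (ENNReal.ofReal p) ν,
        newtonianNorm p (weightedMeasure K ε β 0 C) (E f) ≤ A * ‖f‖) ∧
      ∀ f : Lp ℝ (ENNReal.ofReal p) ν, ∀ᵐ ξ ∂ν,
        Tendsto (fun t : ℝ => (E f : RegularTree K ε → ℝ) (TreeBoundary.ray ε ξ t))
          atTop (𝓝 (f ξ)) := by
  have hp0 : 0 < p := by linarith
  have := hν.isFiniteMeasure hK hε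
  have := isFiniteMeasure_weightedMeasure hK hε hβ hC 0 hν
  obtain ⟨A, hA, hAh⟩ := exists_interpolate_bound hK hε hβ hp_eq hp hC hν
  set μ := weightedMeasure K ε β 0 C
  have hex : ∀ f : Lp ℝ (ENNReal.ofReal p) ν, ∃ H : List (Fin K) → ℝ,
      ∫⁻ x, ‖interpolate H x‖ₑ ^ p ∂μ ≤ A * (2 ^ p * 2 * ∫⁻ ξ, ‖f ξ‖ₑ ^ p ∂ν) ∧
      ∫⁻ x, interpolateSlope H x ^ p ∂μ ≤ A * (2 ^ p * 2 * ∫⁻ ξ, ‖f ξ‖ₑ ^ p ∂ν) ∧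
      ∀ᵐ ξ ∂ν, Tendsto (fun n => H (TreeBoundary.prefixWord ξ n)) atTop (𝓝 (f ξ)) := by
    intro f
    obtain ⟨H, h1, h2, h3⟩ := TreeBoundary.exists_vertexFunction (by omega) hp
      (Lp.stronglyMeasurable f).measurable (Lp.memLp f)
    obtain ⟨h4, h5⟩ := hAh H _ h1 h2
    exact ⟨H, h4, h5, h3⟩
  choose H hu hg hlim using hex
  have hS : ∀ f : Lp ℝ (ENNReal.ofReal p) ν,
      (∫⁻ ξ, ‖f ξ‖ₑ ^ p ∂ν) = eLpNorm f (ENNReal.ofReal p) ν ^ p := fun f => by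
    rw [eLpNorm_eq_lintegral_rpow_enorm_toReal (by simpa using hp0) (by simp),
      ENNReal.toReal_ofReal hp0.le, ← ENNReal.rpow_mul, one_div_mul_cancel hp0.ne',
      ENNReal.rpow_one]
  set B := A * (2 ^ p * 2) with hB
  have hBtop : B ≠ ∞ := ENNReal.mul_ne_top hA (ENNReal.mul_ne_top
    (ENNReal.rpow_ne_top_of_nonneg hp0.le (by simp)) (by simp))
  simp only [← mul_assoc, hS] at hu hg
  rw [mul_assoc A, ← hB] at hu hg
  have hfin : ∀ f : Lp ℝ (ENNReal.ofReal p) ν, B * eLpNorm f (ENNReal.ofReal p) ν ^ p < ∞ :=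
    fun f => ENNReal.mul_lt_top hBtop.lt_top
      (ENNReal.rpow_lt_top_of_nonneg hp0.le (Lp.eLpNorm_ne_top f))
  refine ⟨fun f => ⟨interpolate (H f), mem_newtonianSpace hp (measurable_interpolate hε _)
    ((hu f).trans_lt (hfin f)) (isUpperGradient_interpolateSlope hε _)
    ((hg f).trans_lt (hfin f))⟩, ⟨((B + B) ^ (1 / p)).toReal, ENNReal.toReal_nonneg, fun f => ?_⟩,
    fun f => ?_⟩
  · have h := (newtonianENorm_le (μ := μ) hp
      (isUpperGradient_interpolateSlope hε (H f))).trans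
      (ENNReal.rpow_le_rpow (add_le_add (hu f) (hg f)) (by positivity))
    rw [← add_mul, ENNReal.mul_rpow_of_nonneg _ _ (by positivity), ← ENNReal.rpow_mul,
      mul_one_div_cancel hp0.ne', ENNReal.rpow_one] at h
    rw [newtonianNorm, Lp.norm_def, ← ENNReal.toReal_mul]
    refine ENNReal.toReal_mono (ENNReal.mul_ne_top (ENNReal.rpow_ne_top_of_nonneg (by positivity)
      (ENNReal.add_ne_top.2 ⟨hBtop, hBtop⟩)) (Lp.eLpNorm_ne_top f)) h
  · filter_upwards [hlim f] with ξ hξ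
    exact tendsto_interpolate_ray hξ

end RegularTree

/-! ### Trace, sharpness and extension -/

theorem theorem1p2 (K : ℕ) (hK : 2 ≤ K) (β ε p : ℝ) (hβ : Real.log K < β) (hε : 0 < ε)
    (hp_eq : p = (β - Real.log K) / ε) (hp : 1 ≤ p)
    (ν : Measure (TreeBoundary K)) (hν : TreeBoundary.AhlforsRegular ε (Real.log K / ε) ν) :
    -- the bounded linear trace operator
    (∀ l C : ℝ, max (2 * |l| / (β - Real.log K)) (2 * Real.log 4 / ε) ≤ C →
      (1 < p → p - 1 < l) → (p = 1 → 0 ≤ l) →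
      ∃ T : RegularTree.newtonianSpace p hp (RegularTree.weightedMeasure K ε β l C) →ₗ[ℝ]
          Lp ℝ (ENNReal.ofReal p) ν,
        (∀ u : RegularTree.newtonianSpace p hp (RegularTree.weightedMeasure K ε β l C),
          ∀ᵐ ξ ∂ν, Tendsto (fun t : ℝ => (u : RegularTree K ε → ℝ) (TreeBoundary.ray ε ξ t))
            atTop (𝓝 (T u ξ))) ∧
        ∃ A : ℝ, 0 ≤ A ∧
          ∀ u : RegularTree.newtonianSpace p hp (RegularTree.weightedMeasure K ε β l C),
            ‖T u‖ ≤ A * RegularTree.newtonianNorm p (RegularTree.weightedMeasure K ε β l C) u) ∧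
    -- sharpness of the condition on the weight
    (1 < p → ∀ δ C : ℝ, 0 < δ →
      max (2 * |p - 1 - δ| / (β - Real.log K)) (2 * Real.log 4 / ε) ≤ C →
      (fun x : RegularTree K ε => Real.log (x.height + 1)) ∈
          RegularTree.newtonianSpace p hp (RegularTree.weightedMeasure K ε β (p - 1 - δ) C) ∧
        ∀ ξ : TreeBoundary K,
          Tendsto (fun t : ℝ => Real.log ((TreeBoundary.ray ε ξ t).height + 1)) atTop atTop) ∧
    -- the bounded (not necessarily linear) extension operator into the unweighted space
    (∀ C : ℝ, 2 * Real.log 4 / ε ≤ C →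
      ∃ E : Lp ℝ (ENNReal.ofReal p) ν →
          RegularTree.newtonianSpace p hp (RegularTree.weightedMeasure K ε β 0 C),
        (∃ A : ℝ, 0 ≤ A ∧ ∀ f : Lp ℝ (ENNReal.ofReal p) ν,
          RegularTree.newtonianNorm p (RegularTree.weightedMeasure K ε β 0 C) (E f) ≤ A * ‖f‖) ∧
        ∀ f : Lp ℝ (ENNReal.ofReal p) ν, ∀ᵐ ξ ∂ν,
          Tendsto (fun t : ℝ => (E f : RegularTree K ε → ℝ) (TreeBoundary.ray ε ξ t))
            atTop (𝓝 (f ξ))) := by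
  have hlog : 0 < Real.log 4 := Real.log_pos (by norm_num)
  have hpos : ∀ C : ℝ, 2 * Real.log 4 / ε ≤ C → 0 < C := fun C hC =>
    lt_of_lt_of_le (by positivity) hC
  refine ⟨fun l C hC h1 h2 => ?_, fun _ δ C hδ hC => ⟨?_, fun ξ => ?_⟩, fun C hC => ?_⟩
  · exact RegularTree.exists_traceOperator hK hε hβ hp_eq hp
      (hpos C ((le_max_right _ _).trans hC)) h1 h2 hν
  · exact RegularTree.log_height_mem_newtonianSpace hK hε hβ hp_eq hp
      (hpos C ((le_max_right _ _).trans hC)) hδ hν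
  · refine Real.tendsto_log_atTop.comp (tendsto_atTop_add_const_right _ 1 ?_)
    exact tendsto_atTop_mono (fun t => le_max_left t 0) tendsto_id
  · exact RegularTree.exists_extensionOperator hK hε hβ hp_eq hp (hpos C hC) hν
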